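/- Let $H$ be a complex Hilbert space, $B(H)$ the algebra of bounded linear operators on $H$ and $B(H)_*$ its predual, i.e. the space of functionals $x\mapsto\sum_n\langle x\xi_n,\eta_n\rangle$ with $\sum_n\|\xi_n\|^2<\infty$ and $\sum_n\|\eta_n\|^2<\infty$; the $\sigma$-weak topology on $B(H)$ is the coarsest one making all these functionals continuous. A multiplicative unitary on $H$ is a unitary $W\in B(H\otimes H)$ (Hilbert space tensor product) with $W_{12}W_{13}W_{23}=W_{23}W_{12}$ on $H\otimes H\otimes H$, where $W_{12}=W\otimes 1$, $W_{23}=1\otimes W$, $W_{13}=(1\otimes\Sigma)W_{12}(1\otimes\Sigma)$ and $\Sigma$ is the flip $\xi\otimes\eta\mapsto\eta\otimes\xi$. Put $$S=\{(\iota\otimes\omega)(W)\mid\omega\in B(H)_*\},\qquad \widehat S=\{(\omega\otimes\iota)(W)\mid\omega\in B(H)_*\},$$ where $\iota$ is the identity map, so that $(\iota\otimes\omega)(a\otimes b)=\omega(b)a$ and $(\omega\otimes\iota)(a\otimes b)=\omega(a)b$, and let $M$ and $\widehat M$ be the von Neumann algebras generated by $S$ and by $\widehat S$, respectively. A multiplicative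 unitary $W$ is called trim if the linear span of $\{s\,\hat s^{*}\mid s\in S,\ \hat s\in\widehat S\}$ is $\sigma$-weakly dense in $B(H)$. A quantum group frame on $H$ is a triple $(W,J,\widehat J)$ where $W$ is a trim multiplicative unitary on $H$, and $J$, $\widehat J$ are anti-linear operators on $H$ such that $J=J^*$, $J^2=1$, $\widehat J=\widehat J^{*}$, $\widehat J^{2}=1$ (so they are anti-unitary involutions), $W^*=(\widehat J\otimes J)W(\widehat J\otimes J)$, $JMJ\subseteq M'$ and $\widehat J\widehat M\widehat J\subseteq\widehat M'$, where $M'$ and $\widehat M'$ are the commutants in $B(H)$. Theorem. Let $(W,J,\widehat J)$ be a quantum group frame on $H$. Then the $\sigma$-weak closure of $S$ is a $*$-algebra, and it coincides with the von Neumann algebra $M$. Similarly, the $\sigma$-weak closure of $\widehat S$ is a $*$-algebra and coincides with the von Neumann algebra $\widehat M$. -/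

import Mathlib

open scoped TensorProduct InnerProductSpace ComplexConjugate

noncomputable section

namespace QGF

universe u

/-! ### Hilbert space tensor products -/

section HilbertTensor

/-- The Hilbert space tensor product: the completion of the algebraic tensor product for the inner
product `⟪a ⊗ b, c ⊗ d⟫ = ⟪a, c⟫ * ⟪b, d⟫`. -/
def HTensor (E F : Type*) [NormedAddCommGroup E] [InnerProductSpace ℂ E]
    [NormedAddCommGroup F] [InnerProductSpace ℂ F] : Type _ :=
  UniformSpace.Completion (E ⊗[ℂ] F)

variable {E F G E' F' : Type*}
  [NormedAddCommGroup E] [InnerProductSpace ℂ E]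
  [NormedAddCommGroup F] [InnerProductSpace ℂ F]
  [NormedAddCommGroup G] [InnerProductSpace ℂ G]
  [NormedAddCommGroup E'] [InnerProductSpace ℂ E']
  [NormedAddCommGroup F'] [InnerProductSpace ℂ F']

instance : NormedAddCommGroup (HTensor E F) :=
  inferInstanceAs (NormedAddCommGroup (UniformSpace.Completion (E ⊗[ℂ] F)))

instance : InnerProductSpace ℂ (HTensor E F) :=
  inferInstanceAs (InnerProductSpace ℂ (UniformSpace.Completion (E ⊗[ℂ] F)))

instance : CompleteSpace (HTensor E F) :=
  inferInstanceAs (CompleteSpace (UniformSpace.Completion (E ⊗[ℂ] F)))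

/-- The dense isometric embedding of the algebraic tensor product. -/
def emb : E ⊗[ℂ] F →ₗᵢ[ℂ] HTensor E F :=
  (UniformSpace.Completion.toComplₗᵢ : E ⊗[ℂ] F →ₗᵢ[ℂ] UniformSpace.Completion (E ⊗[ℂ] F))

theorem denseRange_emb : DenseRange (emb : E ⊗[ℂ] F →ₗᵢ[ℂ] HTensor E F) :=
  UniformSpace.Completion.denseRange_coe (α := E ⊗[ℂ] F)

/-- The elementary tensor `x ⊗ y` in the Hilbert space tensor product. -/
def tmulH (x : E) (y : F) : HTensor E F := emb (x ⊗ₜ[ℂ] y)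

@[simp] theorem inner_tmulH (x x' : E) (y y' : F) :
    ⟪tmulH x y, tmulH x' y'⟫_ℂ = ⟪x, x'⟫_ℂ * ⟪y, y'⟫_ℂ := by
  rw [tmulH, tmulH, LinearIsometry.inner_map_map, TensorProduct.inner_tmul]

/-- `x ↦ (y ↦ x ⊗ y)`. -/
def leftLeg : E →L[ℂ] F →L[ℂ] HTensor E F :=
  (ContinuousLinearMap.compL ℂ F (E ⊗[ℂ] F) (HTensor E F) emb.toContinuousLinearMap).comp
    (TensorProduct.mkL ℂ E F)

/-- `y ↦ (x ↦ x ⊗ y)`. -/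
def rightLeg : F →L[ℂ] E →L[ℂ] HTensor E F := (leftLeg : E →L[ℂ] F →L[ℂ] HTensor E F).flip

@[simp] theorem leftLeg_apply (x : E) (y : F) : leftLeg x y = tmulH x y := rfl

@[simp] theorem rightLeg_apply (x : E) (y : F) : rightLeg y x = tmulH x y := rfl

/-- The continuous extension to the Hilbert space tensor products of a bounded linear or
anti-linear operator between algebraic tensor products. -/
def extendH {σ : ℂ →+* ℂ} (f : E ⊗[ℂ] F →SL[σ] E' ⊗[ℂ] F') : HTensor E F →SL[σ] HTensor E' F' :=
  (f.completion : UniformSpace.Completion (E ⊗[ℂ] F) →SL[σ] UniformSpace.Completion (E' ⊗[ℂ] F'))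

@[simp] theorem extendH_emb {σ : ℂ →+* ℂ} (f : E ⊗[ℂ] F →SL[σ] E' ⊗[ℂ] F') (t : E ⊗[ℂ] F) :
    extendH f (emb t) = emb (f t) :=
  f.completion_apply_coe t

/-- The tensor product `a ⊗ b` of two bounded operators. -/
def mapH (a : E →L[ℂ] E') (b : F →L[ℂ] F') : HTensor E F →L[ℂ] HTensor E' F' :=
  extendH (TensorProduct.mapL a b)

@[simp] theorem mapH_tmulH (a : E →L[ℂ] E') (b : F →L[ℂ] F') (x : E) (y : F) :
    mapH a b (tmulH x y) = tmulH (a x) (b y) := by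
  simp [mapH, tmulH]

/-- The flip `Σ (x ⊗ y) = y ⊗ x`. -/
def flipH : HTensor E F →L[ℂ] HTensor F E :=
  extendH ((TensorProduct.commIsometry ℂ E F).toContinuousLinearEquiv :
    E ⊗[ℂ] F →L[ℂ] F ⊗[ℂ] E)

@[simp] theorem flipH_tmulH (x : E) (y : F) : flipH (tmulH x y) = tmulH y x := by
  simp [flipH, tmulH]

/-- The embedding of the algebraic tensor product `(E ⊗ F) ⊗ G` in the Hilbert space one. -/
def triLeft : (E ⊗[ℂ] F) ⊗[ℂ] G →ₗᵢ[ℂ] HTensor (HTensor E F) G :=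
  emb.comp (emb.rTensor G)

/-- The embedding of the algebraic tensor product `E ⊗ (F ⊗ G)` in the Hilbert space one. -/
def triRight : E ⊗[ℂ] (F ⊗[ℂ] G) →ₗᵢ[ℂ] HTensor E (HTensor F G) :=
  emb.comp (emb.lTensor E)

/-- A closed subspace containing all elementary tensors is everything. -/
theorem mem_of_tmulH_mem (p : Submodule ℂ (HTensor E F))
    (hp : IsClosed (p : Set (HTensor E F))) (h : ∀ x y, tmulH x y ∈ p) (t : HTensor E F) :
    t ∈ p := by
  induction t using denseRange_emb.induction_on with
  | hp => exact hp
  | ih a =>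
    induction a with
    | zero => simp
    | add a b ha hb => rw [map_add]; exact p.add_mem ha hb
    | tmul x y => exact h x y

theorem denseRange_triLeft :
    DenseRange (triLeft : (E ⊗[ℂ] F) ⊗[ℂ] G →ₗᵢ[ℂ] HTensor (HTensor E F) G).toLinearMap := by
  intro t
  let p := (LinearMap.range
    (triLeft : (E ⊗[ℂ] F) ⊗[ℂ] G →ₗᵢ[ℂ] HTensor (HTensor E F) G).toLinearMap).topologicalClosure
  have hp : IsClosed (p : Set (HTensor (HTensor E F) G)) := Submodule.isClosed_topologicalClosure _
  refine mem_of_tmulH_mem p hp (fun s z => ?_) t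
  induction s using denseRange_emb.induction_on with
  | hp => exact hp.preimage (rightLeg (E := HTensor E F) z).continuous
  | ih a => exact subset_closure ⟨a ⊗ₜ z, rfl⟩

theorem denseRange_triRight :
    DenseRange (triRight : E ⊗[ℂ] (F ⊗[ℂ] G) →ₗᵢ[ℂ] HTensor E (HTensor F G)).toLinearMap := by
  intro t
  let p := (LinearMap.range
    (triRight : E ⊗[ℂ] (F ⊗[ℂ] G) →ₗᵢ[ℂ] HTensor E (HTensor F G)).toLinearMap).topologicalClosure
  have hp : IsClosed (p : Set (HTensor E (HTensor F G))) := Submodule.isClosed_topologicalClosure _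
  refine mem_of_tmulH_mem p hp (fun x s => ?_) t
  induction s using denseRange_emb.induction_on with
  | hp => exact hp.preimage (leftLeg (F := HTensor F G) x).continuous
  | ih a => exact subset_closure ⟨x ⊗ₜ a, rfl⟩

variable (E F G) in
/-- The canonical identification `(E ⊗ F) ⊗ G ≃ E ⊗ (F ⊗ G)`. -/
def assocH : HTensor (HTensor E F) G ≃ₗᵢ[ℂ] HTensor E (HTensor F G) :=
  (TensorProduct.assoc ℂ E F G).extendOfIsometry triLeft.toLinearMap triRight.toLinearMap
    denseRange_triLeft denseRange_triRight fun x => by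
      change ‖triRight _‖ = ‖triLeft x‖
      rw [LinearIsometry.norm_map, LinearIsometry.norm_map, TensorProduct.norm_assoc]

@[simp] theorem assocH_tmulH (x : E) (y : F) (z : G) :
    assocH E F G (tmulH (tmulH x y) z) = tmulH x (tmulH y z) :=
  LinearEquiv.extendOfIsometry_eq (TensorProduct.assoc ℂ E F G) triLeft.toLinearMap
    triRight.toLinearMap denseRange_triLeft denseRange_triRight _ ((x ⊗ₜ y) ⊗ₜ z)

@[simp] theorem assocH_symm_tmulH (x : E) (y : F) (z : G) :
    (assocH E F G).symm (tmulH x (tmulH y z)) = tmulH (tmulH x y) z := by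
  rw [← assocH_tmulH, LinearIsometryEquiv.symm_apply_apply]

end HilbertTensor

variable {H : Type u} [NormedAddCommGroup H] [InnerProductSpace ℂ H]

/-! ### Multiplicative unitaries -/

/-- `W₁₂ = W ⊗ 1` on `H ⊗ (H ⊗ H)`. -/
def leg12 (W : HTensor H H →L[ℂ] HTensor H H) :
    HTensor H (HTensor H H) →L[ℂ] HTensor H (HTensor H H) :=
  ((assocH H H H : HTensor (HTensor H H) H →L[ℂ] HTensor H (HTensor H H)).comp
    (mapH W (ContinuousLinearMap.id ℂ H))).comp
    ((assocH H H H).symm : HTensor H (HTensor H H) →L[ℂ] HTensor (HTensor H H) H)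

/-- `W₂₃ = 1 ⊗ W` on `H ⊗ (H ⊗ H)`. -/
def leg23 (W : HTensor H H →L[ℂ] HTensor H H) :
    HTensor H (HTensor H H) →L[ℂ] HTensor H (HTensor H H) :=
  mapH (ContinuousLinearMap.id ℂ H) W

/-- `W₁₃ = (1 ⊗ Σ) W₁₂ (1 ⊗ Σ)` on `H ⊗ (H ⊗ H)`. -/
def leg13 (W : HTensor H H →L[ℂ] HTensor H H) :
    HTensor H (HTensor H H) →L[ℂ] HTensor H (HTensor H H) :=
  leg23 flipH * leg12 W * leg23 flipH

/-- A multiplicative unitary: a unitary with `W₁₂ W₁₃ W₂₃ = W₂₃ W₁₂`. -/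
structure IsMultiplicativeUnitary (W : HTensor H H →L[ℂ] HTensor H H) : Prop where
  mem_unitary : W ∈ unitary (HTensor H H →L[ℂ] HTensor H H)
  pentagon : leg12 W * leg13 W * leg23 W = leg23 W * leg12 W

/-! ### The predual, the `σ`-weak topology and generated von Neumann algebras -/

variable (H) in
/-- The predual `B(H)_*`: the functionals of the form `x ↦ ∑ₙ ⟨x ξₙ, ηₙ⟩` with
`∑ₙ ‖ξₙ‖² < ∞` and `∑ₙ ‖ηₙ‖² < ∞`. -/
def predual : Set (StrongDual ℂ (H →L[ℂ] H)) :=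
  {ω | ∃ ξ η : ℕ → H, Summable (fun n => ‖ξ n‖ ^ 2) ∧ Summable (fun n => ‖η n‖ ^ 2) ∧
    ∀ x : H →L[ℂ] H, HasSum (fun n => ⟪η n, x (ξ n)⟫_ℂ) (ω x)}

variable (H) in
/-- The `σ`-weak topology on `B(H)`: the coarsest topology making every element of the predual
continuous. -/
@[reducible] def sigmaWeakTopology : TopologicalSpace (H →L[ℂ] H) :=
  TopologicalSpace.induced (fun x (ω : predual H) => (ω : StrongDual ℂ (H →L[ℂ] H)) x)
    Pi.topologicalSpace

/-- The `σ`-weak closure of a set of operators. -/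
def sigmaWeakClosure (s : Set (H →L[ℂ] H)) : Set (H →L[ℂ] H) :=
  @closure _ (sigmaWeakTopology H) s

/-! ### Anti-unitary involutions -/

variable (H) in
/-- An anti-linear operator `J` on `H` with `J = J*` (that is, `⟨J x, y⟩ = ⟨J y, x⟩`) and
`J² = 1`. Such an operator is automatically anti-unitary. -/
structure AntiunitaryInvolution where
  toFun : H →ₗ⋆[ℂ] H
  selfAdjoint : ∀ x y, ⟪toFun x, y⟫_ℂ = ⟪toFun y, x⟫_ℂ
  involutive : ∀ x, toFun (toFun x) = x

namespace AntiunitaryInvolution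

theorem inner_map_map (J : AntiunitaryInvolution H) (x y : H) :
    ⟪J.toFun x, J.toFun y⟫_ℂ = ⟪y, x⟫_ℂ := by
  rw [J.selfAdjoint, J.involutive]

/-- `J` as a bounded anti-linear operator. -/
def toCLM (J : AntiunitaryInvolution H) : H →L⋆[ℂ] H :=
  J.toFun.mkContinuous 1 fun x => by
    rw [one_mul, @norm_eq_sqrt_re_inner ℂ, @norm_eq_sqrt_re_inner ℂ _ _ _ _ x, J.inner_map_map]

/-- `x ↦ J x J` on bounded linear operators. -/
def conjugate (J : AntiunitaryInvolution H) (x : H →L[ℂ] H) : H →L[ℂ] H :=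
  J.toCLM.comp (x.comp J.toCLM)

theorem inner_map_tensor (J K : AntiunitaryInvolution H) (s t : H ⊗[ℂ] H) :
    ⟪TensorProduct.map J.toFun K.toFun s, TensorProduct.map J.toFun K.toFun t⟫_ℂ = ⟪t, s⟫_ℂ := by
  induction s with
  | zero => simp
  | add s s' hs hs' => simp [inner_add_left, inner_add_right, hs, hs']
  | tmul x y =>
    induction t with
    | zero => simp
    | add t t' ht ht' => rw [map_add, inner_add_left, inner_add_right, ht, ht']
    | tmul x' y' => simp [inner_map_map]

/-- The anti-linear operator `J ⊗ K` on `H ⊗ H`, with `(J ⊗ K)(x ⊗ y) = J x ⊗ K y`. -/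
def tensor (J K : AntiunitaryInvolution H) : HTensor H H →L⋆[ℂ] HTensor H H :=
  extendH ((TensorProduct.map J.toFun K.toFun).mkContinuous 1 fun t => by
    rw [one_mul, @norm_eq_sqrt_re_inner ℂ, @norm_eq_sqrt_re_inner ℂ _ _ _ _ t, inner_map_tensor])

@[simp] theorem tensor_tmulH (J K : AntiunitaryInvolution H) (x y : H) :
    J.tensor K (tmulH x y) = tmulH (J.toFun x) (K.toFun y) := by
  simp [tensor, tmulH]

end AntiunitaryInvolution

variable [CompleteSpace H]

/-- The von Neumann algebra generated by a set of operators: the bicommutant of its union with its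
adjoint. -/
def generatedVN (s : Set (H →L[ℂ] H)) : VonNeumannAlgebra H where
  toStarSubalgebra :=
    StarSubalgebra.centralizer ℂ (StarSubalgebra.centralizer ℂ s : Set (H →L[ℂ] H))
  centralizer_centralizer' := by
    change Set.centralizer (Set.centralizer (Set.centralizer _)) = Set.centralizer _
    rw [Set.centralizer_centralizer_centralizer]

/-- `generatedVN s` is the smallest von Neumann algebra containing `s`. -/
theorem isLeast_generatedVN (s : Set (H →L[ℂ] H)) :
    IsLeast {N : VonNeumannAlgebra H | s ⊆ N} (generatedVN s) := by
  have key : ((generatedVN s : VonNeumannAlgebra H) : Set (H →L[ℂ] H)) =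
      Set.centralizer (Set.centralizer (s ∪ star s)) := by
    change ((StarSubalgebra.centralizer ℂ
      (StarSubalgebra.centralizer ℂ s : Set (H →L[ℂ] H)) : StarSubalgebra ℂ (H →L[ℂ] H)) :
        Set (H →L[ℂ] H)) = _
    exact StarSubalgebra.coe_centralizer_centralizer ℂ s
  constructor
  · change s ⊆ ((generatedVN s : VonNeumannAlgebra H) : Set (H →L[ℂ] H))
    rw [key]
    exact Set.subset_union_left.trans Set.subset_centralizer_centralizer
  · intro N hN
    change ((generatedVN s : VonNeumannAlgebra H) : Set (H →L[ℂ] H)) ⊆ N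
    rw [key, ← N.centralizer_centralizer]
    refine Set.centralizer_subset (Set.centralizer_subset (Set.union_subset hN ?_))
    intro x hx
    have := star_mem (hN hx)
    simpa using this

/-! ### Slice maps -/

/-- For an operator `T` on `K` and a family of operators `L x : H → K` depending linearly on `x`,
the operator `A` on `H` with `⟨A x, y⟩ = ω ((L y)* T (L x))`. -/
def sliceAlong {K : Type*} [NormedAddCommGroup K] [InnerProductSpace ℂ K] [CompleteSpace K]
    (L : H →L[ℂ] H →L[ℂ] K) (T : K →L[ℂ] K) (ω : StrongDual ℂ (H →L[ℂ] H)) : H →L[ℂ] H :=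
  ContinuousLinearMap.adjoint (InnerProductSpace.continuousLinearMapOfBilin
    (LinearMap.mkContinuous₂
      (LinearMap.mk₂'ₛₗ (starRingEnd ℂ) (RingHom.id ℂ)
        (fun y x => ω ((ContinuousLinearMap.adjoint (L y)).comp (T.comp (L x))))
        (fun y y' x => by simp [ContinuousLinearMap.add_comp])
        (fun c y x => by
          simp only [map_smulₛₗ, ContinuousLinearMap.smul_comp, smul_eq_mul, RingHom.id_apply])
        (fun y x x' => by simp [ContinuousLinearMap.comp_add])
        (fun c y x => by simp))
      (‖ω‖ * ‖L‖ * ‖T‖ * ‖L‖) (fun y x => by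
        have h1 : ‖(ContinuousLinearMap.adjoint (L y)).comp (T.comp (L x))‖ ≤
            (‖L‖ * ‖y‖) * (‖T‖ * (‖L‖ * ‖x‖)) := by
          refine (ContinuousLinearMap.opNorm_comp_le _ _).trans ?_
          refine mul_le_mul ?_ ?_ (norm_nonneg _) (by positivity)
          · rw [LinearIsometryEquiv.norm_map]; exact L.le_opNorm y
          · refine (ContinuousLinearMap.opNorm_comp_le _ _).trans ?_
            exact mul_le_mul_of_nonneg_left (L.le_opNorm x) (norm_nonneg _)
        calc ‖ω ((ContinuousLinearMap.adjoint (L y)).comp (T.comp (L x)))‖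
            ≤ ‖ω‖ * ((‖L‖ * ‖y‖) * (‖T‖ * (‖L‖ * ‖x‖))) :=
              (ω.le_opNorm _).trans (mul_le_mul_of_nonneg_left h1 (norm_nonneg _))
          _ = ‖ω‖ * ‖L‖ * ‖T‖ * ‖L‖ * ‖y‖ * ‖x‖ := by ring)))

theorem inner_sliceAlong {K : Type*} [NormedAddCommGroup K] [InnerProductSpace ℂ K]
    [CompleteSpace K] (L : H →L[ℂ] H →L[ℂ] K) (T : K →L[ℂ] K) (ω : StrongDual ℂ (H →L[ℂ] H))
    (x y : H) :
    ⟪y, sliceAlong L T ω x⟫_ℂ = ω ((ContinuousLinearMap.adjoint (L y)).comp (T.comp (L x))) := by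
  rw [sliceAlong, ContinuousLinearMap.adjoint_inner_right,
    InnerProductSpace.continuousLinearMapOfBilin_apply]
  rfl

/-- `(ι ⊗ ω)(T)`. -/
def sliceRight (ω : StrongDual ℂ (H →L[ℂ] H)) (T : HTensor H H →L[ℂ] HTensor H H) : H →L[ℂ] H :=
  sliceAlong leftLeg T ω

/-- `(ω ⊗ ι)(T)`. -/
def sliceLeft (ω : StrongDual ℂ (H →L[ℂ] H)) (T : HTensor H H →L[ℂ] HTensor H H) : H →L[ℂ] H :=
  sliceAlong rightLeg T ω

theorem adjoint_leftLeg_tmulH (x y z : H) :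
    ContinuousLinearMap.adjoint (leftLeg x : H →L[ℂ] HTensor H H) (tmulH y z) = ⟪x, y⟫_ℂ • z := by
  refine ext_inner_left ℂ fun w => ?_
  rw [ContinuousLinearMap.adjoint_inner_right, leftLeg_apply, inner_tmulH, inner_smul_right]

theorem adjoint_rightLeg_tmulH (x y z : H) :
    ContinuousLinearMap.adjoint (rightLeg x : H →L[ℂ] HTensor H H) (tmulH y z) = ⟪x, z⟫_ℂ • y := by
  refine ext_inner_left ℂ fun w => ?_
  rw [ContinuousLinearMap.adjoint_inner_right, rightLeg_apply, inner_tmulH, inner_smul_right, mul_comm]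

/-- `(ι ⊗ ω)(a ⊗ b) = ω(b) a`. -/
theorem sliceRight_mapH (ω : StrongDual ℂ (H →L[ℂ] H)) (a b : H →L[ℂ] H) :
    sliceRight ω (mapH a b) = ω b • a := by
  ext x
  refine ext_inner_left ℂ fun y => ?_
  have h : (ContinuousLinearMap.adjoint (leftLeg y : H →L[ℂ] HTensor H H)).comp
      ((mapH a b).comp (leftLeg x)) = ⟪y, a x⟫_ℂ • b := by
    ext z; simp [adjoint_leftLeg_tmulH]
  rw [sliceRight, inner_sliceAlong, h]
  simp [inner_smul_right, mul_comm]

/-- `(ω ⊗ ι)(a ⊗ b) = ω(a) b`. -/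
theorem sliceLeft_mapH (ω : StrongDual ℂ (H →L[ℂ] H)) (a b : H →L[ℂ] H) :
    sliceLeft ω (mapH a b) = ω a • b := by
  ext x
  refine ext_inner_left ℂ fun y => ?_
  have h : (ContinuousLinearMap.adjoint (rightLeg y : H →L[ℂ] HTensor H H)).comp
      ((mapH a b).comp (rightLeg x)) = ⟪y, b x⟫_ℂ • a := by
    ext z; simp [adjoint_rightLeg_tmulH]
  rw [sliceLeft, inner_sliceAlong, h]
  simp [inner_smul_right, mul_comm]

/-! ### The algebras of a multiplicative unitary -/

/-- `S = {(ι ⊗ ω)(W) | ω ∈ B(H)_*}`. -/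
def algS (W : HTensor H H →L[ℂ] HTensor H H) : Set (H →L[ℂ] H) :=
  {s | ∃ ω ∈ predual H, sliceRight ω W = s}

/-- `Ŝ = {(ω ⊗ ι)(W) | ω ∈ B(H)_*}`. -/
def algShat (W : HTensor H H →L[ℂ] HTensor H H) : Set (H →L[ℂ] H) :=
  {s | ∃ ω ∈ predual H, sliceLeft ω W = s}

/-- `M`, the von Neumann algebra generated by `S`. -/
def algM (W : HTensor H H →L[ℂ] HTensor H H) : VonNeumannAlgebra H := generatedVN (algS W)

/-- `M̂`, the von Neumann algebra generated by `Ŝ`. -/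
def algMhat (W : HTensor H H →L[ℂ] HTensor H H) : VonNeumannAlgebra H := generatedVN (algShat W)

/-- `W` is trim: the linear span of `{s ŝ* | s ∈ S, ŝ ∈ Ŝ}` is `σ`-weakly dense in `B(H)`. -/
def IsTrim (W : HTensor H H →L[ℂ] HTensor H H) : Prop :=
  sigmaWeakClosure (Submodule.span ℂ {x : H →L[ℂ] H | ∃ s ∈ algS W, ∃ t ∈ algShat W,
    x = s * star t} : Set (H →L[ℂ] H)) = Set.univ

/-! ### Quantum group frames -/

/-- `(W, J, Ĵ)` is a quantum group frame. -/
structure IsQuantumGroupFrame (W : HTensor H H →L[ℂ] HTensor H H)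
    (J Jhat : AntiunitaryInvolution H) : Prop where
  isMultiplicativeUnitary : IsMultiplicativeUnitary W
  isTrim : IsTrim W
  star_eq : star W = (Jhat.tensor J).comp (W.comp (Jhat.tensor J))
  conj_M : ∀ m ∈ algM W, J.conjugate m ∈ (algM W).commutant
  conj_Mhat : ∀ m ∈ algMhat W, Jhat.conjugate m ∈ (algMhat W).commutant

end QGF

end

/-! By the bipolar theorem the `σ`-weak closure of a subspace is determined by the normal
functionals vanishing on it (`mem_sigmaWeakClosure_iff`). Inclusions between closures are therefore
proved by showing that a normal functional killing one set kills another.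

That the closure of S is an algebra needs only the pentagon equation: in W₁₂W₁₃ = W₂₃W₁₂W₂₃*, the
outer factors act on the two legs that are sliced away, so products of slices of W are limits of
slices of W.

For the adjoint, write the pentagon equation as W₁₃W₂₃W₁₂* = W₁₂*W₂₃. If the middle factor W₂₃ on
the left could be replaced by 1, slicing would compare S S* with S*. Since x on leg two commutes
with W₁₃ and b on leg three commutes with W₁₂*, W may be replaced by any (x ⊗ 1)W(1 ⊗ b). It
therefore suffices that these operators are total in B(H ⊗ H); this is weak regularity,
`IsQuantumGroupFrame.eq_zero_of_regular`. It follows that S* and the span of S S* have the same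
closure. The latter span is self-adjoint, hence so is the closure of S.

Weak regularity is where J and Ĵ enter. Put U = JĴ and V = (U ⊗ 1)W(U* ⊗ 1). Conjugating the
pentagon equation by Ĵ ⊗ J ⊗ J gives W₁₂*V₂₃ = V₂₃W₁₂*W₁₃*, and JMJ ⊆ M' shows that W commutes with
U*mU ⊗ 1 for m in M. Together they rewrite (U*sŝ*U ⊗ 1)W(1 ⊗ b) as W times an expression in
W₁₂*W₁₃*; the last factor is absorbed by unitarity, and trimness lets sŝ* range over a total set
(`mapH_slice_mul_apply`, `eq_zero_mul_mapH`).

The closure of S is then a nondegenerate *-algebra, and the double commutant theorem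
(`eq_zero_of_mem_bicommutant`) identifies it with M. The statement for Ŝ is the same theorem applied
to the dual ΣW*Σ, which forms a frame with J and Ĵ exchanged (`IsQuantumGroupFrame.dual`). -/

open scoped InnerProduct

noncomputable section

namespace QGF

universe u

set_option linter.unusedSectionVars false

/-! ### Operators on Hilbert space tensor products -/

section TensorOperators

variable {E F G E' F' E'' F'' X : Type*}
  [NormedAddCommGroup E] [InnerProductSpace ℂ E]
  [NormedAddCommGroup F] [InnerProductSpace ℂ F]
  [NormedAddCommGroup G] [InnerProductSpace ℂ G]
  [NormedAddCommGroup E'] [InnerProductSpace ℂ E']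
  [NormedAddCommGroup F'] [InnerProductSpace ℂ F']
  [NormedAddCommGroup E''] [InnerProductSpace ℂ E'']
  [NormedAddCommGroup F''] [InnerProductSpace ℂ F'']
  [NormedAddCommGroup X] [NormedSpace ℂ X]

/-- Bounded semilinear operators on a Hilbert space tensor product that agree on elementary
tensors are equal. -/
theorem semilinear_ext {σ : ℂ →+* ℂ} {f g : HTensor E F →SL[σ] X}
    (h : ∀ x y, f (tmulH x y) = g (tmulH x y)) : f = g := by
  ext t
  exact mem_of_tmulH_mem (LinearMap.eqLocus f.toLinearMap g.toLinearMap)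
    (isClosed_eq f.continuous g.continuous) h t

/-- Bounded semilinear operators on a threefold tensor product that agree on elementary tensors
are equal. -/
theorem semilinear_ext₃ {σ : ℂ →+* ℂ} {f g : HTensor E (HTensor F G) →SL[σ] X}
    (h : ∀ x y z, f (tmulH x (tmulH y z)) = g (tmulH x (tmulH y z))) : f = g := by
  refine semilinear_ext fun x t => ?_
  have : f.comp (leftLeg x) = g.comp (leftLeg x) := semilinear_ext fun y z => h x y z
  exact DFunLike.congr_fun this t

/-- A vector orthogonal to all elementary tensors vanishes. -/
theorem eq_zero_of_inner_tmulH {t : HTensor E F} (h : ∀ x y, ⟪tmulH x y, t⟫_ℂ = 0) : t = 0 := by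
  have : innerSL ℂ t = 0 := by
    refine semilinear_ext fun x y => ?_
    simpa [inner_conj_symm] using congrArg conj (h x y)
  have h2 := DFunLike.congr_fun this t
  simpa using h2

theorem eq_of_inner_tmulH {s t : HTensor E F}
    (h : ∀ x y, ⟪tmulH x y, s⟫_ℂ = ⟪tmulH x y, t⟫_ℂ) : s = t :=
  sub_eq_zero.1 (eq_zero_of_inner_tmulH fun x y => by rw [inner_sub_right, h, sub_self])

theorem norm_tmulH (x : E) (y : F) : ‖tmulH x y‖ = ‖x‖ * ‖y‖ := by
  rw [tmulH, LinearIsometry.norm_map, TensorProduct.norm_tmul]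

theorem mapH_comp_mapH (a : E' →L[ℂ] E'') (b : F' →L[ℂ] F'') (c : E →L[ℂ] E') (d : F →L[ℂ] F') :
    mapH a b ∘L mapH c d = mapH (a ∘L c) (b ∘L d) :=
  semilinear_ext fun x y => by simp

theorem mapH_mul (a c : E →L[ℂ] E) (b d : F →L[ℂ] F) :
    mapH a b * mapH c d = mapH (a * c) (b * d) :=
  mapH_comp_mapH a b c d

@[simp] theorem mapH_one : mapH (1 : E →L[ℂ] E) (1 : F →L[ℂ] F) = 1 :=
  semilinear_ext fun x y => by simp

theorem tmulH_add_right (x : E) (y y' : F) : tmulH x (y + y') = tmulH x y + tmulH x y' :=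
  map_add (leftLeg x) y y'

theorem tmulH_smul_left (c : ℂ) (x : E) (y : F) : tmulH (c • x) y = c • tmulH x y :=
  map_smul (rightLeg y) c x

theorem tmulH_smul_right (c : ℂ) (x : E) (y : F) : tmulH x (c • y) = c • tmulH x y :=
  map_smul (leftLeg x) c y

theorem mapH_add_right (a : E →L[ℂ] E') (b b' : F →L[ℂ] F') :
    mapH a (b + b') = mapH a b + mapH a b' :=
  semilinear_ext fun x y => by simp [tmulH_add_right]

theorem mapH_smul_right (c : ℂ) (a : E →L[ℂ] E') (b : F →L[ℂ] F') :
    mapH a (c • b) = c • mapH a b :=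
  semilinear_ext fun x y => by simp [tmulH_smul_right]

theorem mapH_comp_leftLeg (a : E →L[ℂ] E') (b : F →L[ℂ] F') (x : E) :
    mapH a b ∘L leftLeg x = leftLeg (a x) ∘L b := by
  ext y; simp

theorem mapH_comp_rightLeg (a : E →L[ℂ] E') (b : F →L[ℂ] F') (y : F) :
    mapH a b ∘L rightLeg y = rightLeg (b y) ∘L a := by
  ext x; simp

@[simp] theorem flipH_comp_flipH : (flipH : HTensor F E →L[ℂ] HTensor E F) ∘L flipH = .id ℂ _ :=
  semilinear_ext fun x y => by simp

@[simp] theorem flipH_mul_flipH : (flipH : HTensor E E →L[ℂ] HTensor E E) * flipH = 1 :=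
  flipH_comp_flipH

theorem flipH_comp_leftLeg (x : E) : (flipH : HTensor E F →L[ℂ] _) ∘L leftLeg x = rightLeg x := by
  ext y; simp

theorem flipH_comp_rightLeg (y : F) : (flipH : HTensor E F →L[ℂ] _) ∘L rightLeg y = leftLeg y := by
  ext x; simp

theorem leftLeg_eq_assocH_comp (x : E) :
    (leftLeg x : HTensor F G →L[ℂ] _) =
      (assocH E F G : _ →L[ℂ] _) ∘L mapH (leftLeg x) (.id ℂ G) :=
  semilinear_ext fun y z => by simp

section Adjoint

variable [CompleteSpace E] [CompleteSpace F] [CompleteSpace G] [CompleteSpace E']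
  [CompleteSpace F']

theorem adjoint_mapH (a : E →L[ℂ] E') (b : F →L[ℂ] F') : (mapH a b)† = mapH (a†) (b†) := by
  refine semilinear_ext fun x y => eq_of_inner_tmulH fun x' y' => ?_
  simp [ContinuousLinearMap.adjoint_inner_right]

theorem adjoint_flipH : (flipH : HTensor E F →L[ℂ] HTensor F E)† = flipH := by
  refine semilinear_ext fun x y => eq_of_inner_tmulH fun x' y' => ?_
  simp [ContinuousLinearMap.adjoint_inner_right, mul_comm]

theorem adjoint_assocH :
    (assocH E F G : HTensor (HTensor E F) G →L[ℂ] HTensor E (HTensor F G))† =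
      ((assocH E F G).symm : HTensor E (HTensor F G) →L[ℂ] HTensor (HTensor E F) G) := by
  simp

theorem adjoint_leftLeg_apply (x : E) (y : E) (z : F) :
    ((leftLeg x : F →L[ℂ] HTensor E F)†) (tmulH y z) = ⟪x, y⟫_ℂ • z := by
  refine ext_inner_left ℂ fun w => ?_
  rw [ContinuousLinearMap.adjoint_inner_right, leftLeg_apply, inner_tmulH, inner_smul_right]

theorem adjoint_rightLeg_apply (x : F) (y : E) (z : F) :
    ((rightLeg x : E →L[ℂ] HTensor E F)†) (tmulH y z) = ⟪x, z⟫_ℂ • y := by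
  refine ext_inner_left ℂ fun w => ?_
  rw [ContinuousLinearMap.adjoint_inner_right, rightLeg_apply, inner_tmulH, inner_smul_right,
    mul_comm]

theorem adjoint_leftLeg_comp_mapH (x : E') (a : E →L[ℂ] E') (b : F →L[ℂ] F') :
    (leftLeg x)† ∘L mapH a b = b ∘L (leftLeg ((a†) x))† := by
  have := congrArg ContinuousLinearMap.adjoint (mapH_comp_leftLeg (a†) (b†) x)
  simpa [ContinuousLinearMap.adjoint_comp, adjoint_mapH] using this

theorem adjoint_rightLeg_comp_mapH (y : F') (a : E →L[ℂ] E') (b : F →L[ℂ] F') :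
    (rightLeg y)† ∘L mapH a b = a ∘L (rightLeg ((b†) y))† := by
  have := congrArg ContinuousLinearMap.adjoint (mapH_comp_rightLeg (a†) (b†) y)
  simpa [ContinuousLinearMap.adjoint_comp, adjoint_mapH] using this

end Adjoint

end TensorOperators

/-! ### Leg numbering on threefold tensor products, and slices of products of legs -/

section Legs

variable {H : Type u} [NormedAddCommGroup H] [InnerProductSpace ℂ H]

@[simp] theorem leg23_tmulH (T : HTensor H H →L[ℂ] HTensor H H) (x : H) (t : HTensor H H) :
    leg23 T (tmulH x t) = tmulH x (T t) := by
  simp [leg23]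

theorem leg12_apply (T : HTensor H H →L[ℂ] HTensor H H) (t : HTensor H H) (z : H) :
    leg12 T (assocH H H H (tmulH t z)) = assocH H H H (tmulH (T t) z) := by
  simp [leg12]

theorem leg12_comp_assocH (T : HTensor H H →L[ℂ] HTensor H H) :
    leg12 T ∘L (assocH H H H : _ →L[ℂ] _) = (assocH H H H : _ →L[ℂ] _) ∘L mapH T (.id ℂ H) := by
  ext t; simp [leg12]

theorem leg23_mul (S T : HTensor H H →L[ℂ] HTensor H H) : leg23 (S * T) = leg23 S * leg23 T := by
  rw [leg23, leg23, leg23, mapH_mul]; rfl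

theorem leg12_mul (S T : HTensor H H →L[ℂ] HTensor H H) : leg12 (S * T) = leg12 S * leg12 T := by
  have : mapH (S * T) (.id ℂ H) = mapH S (.id ℂ H) * mapH T (.id ℂ H) := by rw [mapH_mul]; rfl
  ext t
  simp [leg12, this]

theorem leg23_flipH_mul_self : leg23 flipH * leg23 flipH = (1 : _ →L[ℂ] HTensor H (HTensor H H)) := by
  rw [← leg23_mul, flipH_mul_flipH]; exact mapH_one

theorem leg13_mul (S T : HTensor H H →L[ℂ] HTensor H H) : leg13 (S * T) = leg13 S * leg13 T := by
  simp only [leg13, leg12_mul, mul_assoc]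
  rw [← mul_assoc (leg23 flipH) (leg23 flipH), leg23_flipH_mul_self, one_mul]

@[simp] theorem leg12_mapH (a b : H →L[ℂ] H) : leg12 (mapH a b) = mapH a (mapH b (.id ℂ H)) :=
  semilinear_ext₃ fun x y z => by simp [leg12]

@[simp] theorem leg13_mapH (a b : H →L[ℂ] H) : leg13 (mapH a b) = mapH a (mapH (.id ℂ H) b) :=
  semilinear_ext₃ fun x y z => by simp [leg13]

@[simp] theorem leg23_mapH (a b : H →L[ℂ] H) : leg23 (mapH a b) = mapH (.id ℂ H) (mapH a b) := rfl

@[simp] theorem leg23_one : leg23 (1 : HTensor H H →L[ℂ] HTensor H H) = 1 := mapH_one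

@[simp] theorem leg12_one : leg12 (1 : HTensor H H →L[ℂ] HTensor H H) = 1 := by
  rw [← mapH_one, leg12_mapH]
  exact (congrArg (mapH 1) mapH_one).trans mapH_one

@[simp] theorem leg13_one : leg13 (1 : HTensor H H →L[ℂ] HTensor H H) = 1 := by
  rw [← mapH_one, leg13_mapH]
  exact (congrArg (mapH 1) mapH_one).trans mapH_one

/-- An operator on the third leg commutes with `T₁₂`. -/
theorem leg12_mul_third (T : HTensor H H →L[ℂ] HTensor H H) (b : H →L[ℂ] H) :
    leg12 T * mapH (.id ℂ H) (mapH (.id ℂ H) b) = mapH (.id ℂ H) (mapH (.id ℂ H) b) * leg12 T := by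
  have h1 : mapH T (.id ℂ H) * mapH (.id ℂ (HTensor H H)) b =
      mapH (.id ℂ (HTensor H H)) b * mapH T (.id ℂ H) := by
    rw [mapH_mul, mapH_mul]; rfl
  have h2 : mapH (.id ℂ H) (mapH (.id ℂ H) b) =
      (assocH H H H : _ →L[ℂ] _) ∘L mapH (.id ℂ (HTensor H H)) b ∘L
        ((assocH H H H).symm : _ →L[ℂ] _) :=
    semilinear_ext₃ fun x y z => by
      simp
  ext t
  have := DFunLike.congr_fun h1 ((assocH H H H).symm t)
  simp only [mul_apply_eq_comp] at this
  simp [leg12, h2, this]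

/-- An operator on the second leg commutes with `T₁₃`. -/
theorem leg13_mul_second (T : HTensor H H →L[ℂ] HTensor H H) (b : H →L[ℂ] H) :
    leg13 T * mapH (.id ℂ H) (mapH b (.id ℂ H)) = mapH (.id ℂ H) (mapH b (.id ℂ H)) * leg13 T := by
  have h : leg23 flipH * mapH (.id ℂ H) (mapH b (.id ℂ H)) =
      mapH (.id ℂ H) (mapH (.id ℂ H) b) * leg23 flipH :=
    semilinear_ext₃ fun x y z => by simp
  have h' : mapH (.id ℂ H) (mapH b (.id ℂ H)) * leg23 flipH =
      leg23 flipH * mapH (.id ℂ H) (mapH (.id ℂ H) b) :=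
    semilinear_ext₃ fun x y z => by simp
  rw [leg13, mul_assoc, h, mul_assoc, ← mul_assoc (leg12 T), leg12_mul_third, ← mul_assoc,
    ← mul_assoc, ← h', mul_assoc, mul_assoc, mul_assoc]

section Complete

variable [CompleteSpace H]

theorem star_mapH (a b : H →L[ℂ] H) : star (mapH a b) = mapH (star a) (star b) :=
  adjoint_mapH a b

theorem star_flipH : star (flipH : HTensor H H →L[ℂ] HTensor H H) = flipH := adjoint_flipH

theorem star_leg23 (T : HTensor H H →L[ℂ] HTensor H H) : star (leg23 T) = leg23 (star T) := by
  simp only [leg23, ContinuousLinearMap.star_eq_adjoint, adjoint_mapH,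
    ContinuousLinearMap.adjoint_id]

theorem star_leg12 (T : HTensor H H →L[ℂ] HTensor H H) : star (leg12 T) = leg12 (star T) := by
  have h : ((assocH H H H).symm : HTensor H (HTensor H H) →L[ℂ] HTensor (HTensor H H) H)† =
      (assocH H H H : HTensor (HTensor H H) H →L[ℂ] HTensor H (HTensor H H)) := by
    rw [← ContinuousLinearMap.adjoint_adjoint (assocH H H H : HTensor (HTensor H H) H →L[ℂ] HTensor H (HTensor H H)),
      adjoint_assocH]
  rw [leg12, ContinuousLinearMap.star_eq_adjoint, ContinuousLinearMap.adjoint_comp,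
    ContinuousLinearMap.adjoint_comp, adjoint_mapH, ContinuousLinearMap.adjoint_id, adjoint_assocH]
  erw [h]
  rfl

theorem star_leg13 (T : HTensor H H →L[ℂ] HTensor H H) : star (leg13 T) = leg13 (star T) := by
  simp only [leg13, star_mul, star_leg12, star_leg23, star_flipH, mul_assoc]

theorem leg12_comp_leftLeg (T : HTensor H H →L[ℂ] HTensor H H) (a : H) :
    leg12 T ∘L leftLeg a =
      (assocH H H H : _ →L[ℂ] _) ∘L mapH (T ∘L leftLeg a) (.id ℂ H) := by
  rw [leftLeg_eq_assocH_comp, ← ContinuousLinearMap.comp_assoc, leg12_comp_assocH,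
    ContinuousLinearMap.comp_assoc, mapH_comp_mapH]
  rfl

/-- Slicing the last two legs of `T₁₂` by elementary tensors. -/
theorem slice_leg12 (T : HTensor H H →L[ℂ] HTensor H H) (p q p' q' : H) :
    (rightLeg (tmulH p q))† ∘L leg12 T ∘L rightLeg (tmulH p' q') =
      ⟪q, q'⟫_ℂ • ((rightLeg p)† ∘L T ∘L rightLeg p') := by
  ext x
  refine ext_inner_left ℂ fun y => ?_
  have : tmulH x (tmulH p' q') = assocH H H H (tmulH (tmulH x p') q') := by simp
  have h2 : tmulH y (tmulH p q) = assocH H H H (tmulH (tmulH y p) q) := by simp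
  simp only [ContinuousLinearMap.comp_apply, ContinuousLinearMap.adjoint_inner_right,
    rightLeg_apply, this, leg12_apply, h2, LinearIsometryEquiv.inner_map_map, inner_tmulH,
    smul_apply, inner_smul_right]
  ring

theorem inner_tmulH_apply (S : HTensor H H →L[ℂ] HTensor H H) (x y z p q q' : H) :
    ⟪tmulH (tmulH z q) p, tmulH (S (tmulH x q')) y⟫_ℂ =
      ⟪z, (((rightLeg q)† ∘L S ∘L rightLeg q') ∘L (rightLeg p)†) (tmulH x y)⟫_ℂ := by
  simp [adjoint_rightLeg_apply, ContinuousLinearMap.adjoint_inner_right, mul_comm]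

/-- Slicing the last two legs of `S₁₃ T₁₂` by elementary tensors. -/
theorem slice_leg13_mul_leg12 (S T : HTensor H H →L[ℂ] HTensor H H) (p q p' q' : H) :
    (rightLeg (tmulH p q))† ∘L (leg13 S * leg12 T) ∘L rightLeg (tmulH p' q') =
      ((rightLeg q)† ∘L S ∘L rightLeg q') * ((rightLeg p)† ∘L T ∘L rightLeg p') := by
  -- Slicing leg three turns S₁₃ into an operator on leg one alone, and this commutes with slicing
  -- leg two by p.
  have key : (rightLeg (tmulH p q))† ∘L leg13 S ∘L (assocH H H H : _ →L[ℂ] _) ∘L rightLeg q' =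
      ((rightLeg q)† ∘L S ∘L rightLeg q') ∘L (rightLeg p)† := by
    refine semilinear_ext fun x y => ext_inner_left ℂ fun z => ?_
    have h1 : tmulH x (tmulH q' y) = assocH H H H (tmulH (tmulH x q') y) := by simp
    have h2 : tmulH z (tmulH q p) = assocH H H H (tmulH (tmulH z q) p) := by simp
    have h3 : star (leg23 (flipH : HTensor H H →L[ℂ] HTensor H H)) = leg23 flipH := by
      rw [star_leg23, star_flipH]
    rw [ContinuousLinearMap.comp_apply, ContinuousLinearMap.adjoint_inner_right, leg13, mul_assoc,
      ContinuousLinearMap.comp_apply, mul_apply_eq_comp, ← ContinuousLinearMap.adjoint_inner_left,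
      ← ContinuousLinearMap.star_eq_adjoint, h3]
    have h5 : leg23 flipH (assocH H H H (tmulH (tmulH x y) q')) = tmulH x (tmulH q' y) := by simp
    have h6 : leg23 flipH (tmulH z (tmulH p q)) = tmulH z (tmulH q p) := by simp
    simp only [ContinuousLinearMap.comp_apply, mul_apply_eq_comp, rightLeg_apply,
      ContinuousLinearEquiv.coe_coe, LinearIsometryEquiv.coe_toContinuousLinearEquiv, h5, h6]
    rw [h1, h2, leg12_apply, LinearIsometryEquiv.inner_map_map, inner_tmulH_apply]
    rfl
  ext x
  have h4 : tmulH x (tmulH p' q') = assocH H H H (tmulH (tmulH x p') q') := by simp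
  have h5 := DFunLike.congr_fun key (T (tmulH x p'))
  simp only [ContinuousLinearMap.comp_apply, mul_apply_eq_comp, rightLeg_apply] at h5 ⊢
  rw [h4, leg12_apply]
  exact h5

/-- Slicing the first leg of `T₁₂`. -/
theorem slice_first_leg12 (T : HTensor H H →L[ℂ] HTensor H H) (p p' : H) :
    (leftLeg p)† ∘L leg12 T ∘L leftLeg p' = mapH ((leftLeg p)† ∘L T ∘L leftLeg p') (.id ℂ H) := by
  refine ContinuousLinearMap.ext fun t => ext_inner_left ℂ fun t' => ?_
  have h := DFunLike.congr_fun (leg12_comp_leftLeg T p') t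
  have h' := DFunLike.congr_fun (leftLeg_eq_assocH_comp p) t'
  rw [ContinuousLinearMap.comp_apply, ContinuousLinearMap.comp_apply] at h
  rw [ContinuousLinearMap.comp_apply] at h'
  rw [ContinuousLinearMap.comp_apply, ContinuousLinearMap.adjoint_inner_right,
    ContinuousLinearMap.comp_apply, h, h']
  refine (LinearIsometryEquiv.inner_map_map _ _ _).trans ?_
  rw [← ContinuousLinearMap.adjoint_inner_right, adjoint_mapH, ← ContinuousLinearMap.comp_apply,
    mapH_comp_mapH, ContinuousLinearMap.adjoint_id]
  rfl

/-- The map `y ↦ x ⊗ y ⊗ z` for `k = x ⊗ z`. -/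
def midLeg : HTensor H H →L[ℂ] H →L[ℂ] HTensor H (HTensor H H) :=
  (ContinuousLinearMap.compL ℂ H (HTensor (HTensor H H) H) (HTensor H (HTensor H H))
    (leg23 flipH ∘L (assocH H H H : HTensor (HTensor H H) H →L[ℂ] HTensor H (HTensor H H)))) ∘L
    leftLeg

theorem midLeg_tmulH (x z : H) : midLeg (tmulH x z) = leftLeg x ∘L rightLeg z := by
  ext y; simp [midLeg]

/-- T₁₃ touches only the outer legs, so when those legs are sliced away it acts on the slicing
vector. -/
theorem leg13_comp_midLeg (T : HTensor H H →L[ℂ] HTensor H H) (k : HTensor H H) :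
    leg13 T ∘L midLeg k = midLeg (T k) := by
  ext y
  have := DFunLike.congr_fun leg23_flipH_mul_self (assocH H H H (tmulH k y))
  simp only [mul_apply_eq_comp, one_apply_eq_self] at this
  simp [midLeg, leg13, this, leg12_apply]

theorem slice_first_leg23 (T : HTensor H H →L[ℂ] HTensor H H) (p : H) :
    leg23 T ∘L leftLeg p = leftLeg p ∘L T :=
  mapH_comp_leftLeg _ _ _

/-- Slicing the outer legs of `T₁₂ S₂₃` by elementary tensors. -/
theorem slice_leg12_mul_leg23 (S T : HTensor H H →L[ℂ] HTensor H H) (p q p' q' : H) :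
    (midLeg (tmulH p q))† ∘L (leg12 T * leg23 S) ∘L midLeg (tmulH p' q') =
      ((leftLeg p)† ∘L T ∘L leftLeg p') * ((rightLeg q)† ∘L S ∘L rightLeg q') := by
  have h := slice_first_leg12 T p p'
  have h2 := adjoint_rightLeg_comp_mapH q ((leftLeg p)† ∘L T ∘L leftLeg p') (.id ℂ H)
  rw [ContinuousLinearMap.adjoint_id, ← h] at h2
  ext x
  have h3 := DFunLike.congr_fun h2 (S (tmulH x q'))
  simp only [ContinuousLinearMap.comp_apply, leftLeg_apply] at h3
  simpa [midLeg_tmulH, ContinuousLinearMap.adjoint_comp] using h3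

/-- Slicing the outer legs of `S₂₃ T₁₂` by elementary tensors. -/
theorem slice_leg23_mul_leg12 (S T : HTensor H H →L[ℂ] HTensor H H) (p q p' q' : H) :
    (midLeg (tmulH p q))† ∘L (leg23 S * leg12 T) ∘L midLeg (tmulH p' q') =
      ((rightLeg q)† ∘L S ∘L rightLeg q') * ((leftLeg p)† ∘L T ∘L leftLeg p') := by
  have h := slice_first_leg12 T p p'
  have h2 : (leftLeg p)† ∘L leg23 S = S ∘L (leftLeg p)† := by
    have := adjoint_leftLeg_comp_mapH p (.id ℂ H) S
    rwa [ContinuousLinearMap.adjoint_id] at this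
  ext x
  have h3 := DFunLike.congr_fun h (tmulH x q')
  have h4 := DFunLike.congr_fun h2 (leg12 T (tmulH p' (tmulH x q')))
  rw [ContinuousLinearMap.comp_apply, ContinuousLinearMap.comp_apply] at h3 h4
  rw [leftLeg_apply, mapH_tmulH, ContinuousLinearMap.id_apply] at h3
  rw [midLeg_tmulH, midLeg_tmulH, ContinuousLinearMap.adjoint_comp]
  simp only [ContinuousLinearMap.comp_apply, mul_apply_eq_comp, leftLeg_apply, rightLeg_apply]
  rw [h4, h3]
  rfl

end Complete

end Legs

/-! ### Normal functionals -/

section Normal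

variable {H : Type u} {K L : Type*}
  [NormedAddCommGroup H] [InnerProductSpace ℂ H]
  [NormedAddCommGroup K] [InnerProductSpace ℂ K] 
  [NormedAddCommGroup L] [InnerProductSpace ℂ L]

/-- A functional on bounded operators is normal if it has the form `x ↦ ∑ₙ ⟨x ξₙ, ηₙ⟩` with
square summable `ξ` and `η`. -/
def IsNormal (φ : (K →L[ℂ] K) → ℂ) : Prop :=
  ∃ ξ η : ℕ → K, Summable (fun n => ‖ξ n‖ ^ 2) ∧ Summable (fun n => ‖η n‖ ^ 2) ∧
    ∀ x : K →L[ℂ] K, HasSum (fun n => ⟪η n, x (ξ n)⟫_ℂ) (φ x)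

theorem isNormal_of_mem_predual {ω : StrongDual ℂ (H →L[ℂ] H)} (h : ω ∈ predual H) :
    IsNormal (fun x => ω x) := h

theorem summable_mul_of_sq {ι : Type*} {f g : ι → ℝ} (hf : Summable fun i => f i ^ 2)
    (hg : Summable fun i => g i ^ 2) : Summable fun i => f i * g i :=
  Summable.of_norm_bounded (hf.add hg) fun i => by
    rw [Real.norm_eq_abs, abs_le]
    constructor <;> nlinarith [sq_nonneg (f i + g i), sq_nonneg (f i - g i), sq_nonneg (f i),
      sq_nonneg (g i)]

/-- Normality may be checked with families over an arbitrary index type. -/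
theorem IsNormal.of_hasSum {ι : Type*} {φ : (K →L[ℂ] K) → ℂ} (ξ η : ι → K)
    (hξ : Summable fun i => ‖ξ i‖ ^ 2) (hη : Summable fun i => ‖η i‖ ^ 2)
    (h : ∀ x : K →L[ℂ] K, HasSum (fun i => ⟪η i, x (ξ i)⟫_ℂ) (φ x)) : IsNormal φ := by
  -- Square summability makes all but countably many ξ i vanish, so the sum can be reindexed along
  -- an injection of the support into ℕ; the values of η off the support do not matter.
  set s : Set ι := Function.support fun i => ‖ξ i‖ ^ 2
  have hs : s.Countable := hξ.countable_support
  obtain ⟨e, he⟩ := hs.exists_injective_nat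
  have h0 : ∀ i, i ∉ Set.range ((↑) : s → ι) → ξ i = 0 := by
    intro i hi
    by_contra h
    exact hi ⟨⟨i, by simpa [s] using h⟩, rfl⟩
  have hext : ∀ (f : s → K) n, n ∉ Set.range e → Function.extend e f 0 n = 0 := fun f n hn => by
    rw [Function.extend_apply' _ _ _ (by simpa using hn)]; rfl
  refine ⟨Function.extend e (fun i => ξ i) 0, Function.extend e (fun i => η i) 0, ?_, ?_, ?_⟩
  · rw [← he.summable_iff (fun n hn => by simp [hext _ n hn])]
    simpa [Function.comp_def, he.extend_apply] using hξ.comp_injective Subtype.val_injective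
  · rw [← he.summable_iff (fun n hn => by simp [hext _ n hn])]
    simpa [Function.comp_def, he.extend_apply] using hη.comp_injective Subtype.val_injective
  · intro x
    rw [← he.hasSum_iff (fun n hn => by simp [hext _ n hn])]
    have := (Function.Injective.hasSum_iff (g := ((↑) : s → ι)) Subtype.val_injective
      (f := fun i => ⟪η i, x (ξ i)⟫_ℂ) (a := φ x) (fun i hi => by simp [h0 i hi])).2 (h x)
    simpa [Function.comp_def, he.extend_apply] using this

/-- A normal functional is given by an element of the predual. -/
theorem IsNormal.exists_mem_predual {φ : (H →L[ℂ] H) → ℂ} (h : IsNormal φ) :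
    ∃ ω ∈ predual H, ∀ x, ω x = φ x := by
  obtain ⟨ξ, η, hξ, hη, hφ⟩ := h
  have hs := summable_mul_of_sq hη hξ
  let f : (H →L[ℂ] H) →ₗ[ℂ] ℂ :=
    { toFun := φ
      map_add' := fun x y => (hφ (x + y)).unique (by
        simp only [add_apply, inner_add_right]; exact (hφ x).add (hφ y))
      map_smul' := fun c x => (hφ (c • x)).unique (by
        simpa [inner_smul_right] using (hφ x).mul_left c) }
  let ω : StrongDual ℂ (H →L[ℂ] H) := f.mkContinuous (∑' n, ‖η n‖ * ‖ξ n‖) fun x => by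
    change ‖φ x‖ ≤ _
    rw [← (hφ x).tsum_eq, ← tsum_mul_right]
    refine tsum_of_norm_bounded (hs.mul_right _).hasSum fun n => ?_
    calc ‖⟪η n, x (ξ n)⟫_ℂ‖ ≤ ‖η n‖ * ‖x (ξ n)‖ := norm_inner_le_norm _ _
      _ ≤ ‖η n‖ * (‖x‖ * ‖ξ n‖) := by gcongr; exact x.le_opNorm _
      _ = _ := by ring
  exact ⟨ω, ⟨ξ, η, hξ, hη, hφ⟩, fun x => rfl⟩

theorem isNormal_vector (p q : K) : IsNormal fun x : K →L[ℂ] K => ⟪p, x q⟫_ℂ :=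
  IsNormal.of_hasSum (ι := Unit) (fun _ => q) (fun _ => p) (Summable.of_finite)
    (Summable.of_finite) fun x =>
      hasSum_unique fun _ : Unit => ⟪p, x q⟫_ℂ

theorem IsNormal.add {φ ψ : (K →L[ℂ] K) → ℂ} (hφ : IsNormal φ) (hψ : IsNormal ψ) :
    IsNormal fun x => φ x + ψ x := by
  obtain ⟨ξ, η, hξ, hη, h⟩ := hφ
  obtain ⟨ξ', η', hξ', hη', h'⟩ := hψ
  refine IsNormal.of_hasSum (ι := ℕ ⊕ ℕ) (Sum.elim ξ ξ') (Sum.elim η η') ?_ ?_ fun x => ?_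
  · exact Summable.sum _ (by simpa [Function.comp_def]) (by simpa [Function.comp_def])
  · exact Summable.sum _ (by simpa [Function.comp_def]) (by simpa [Function.comp_def])
  · exact HasSum.sum (by simpa [Function.comp_def] using h x)
      (by simpa [Function.comp_def] using h' x)

theorem IsNormal.smul {φ : (K →L[ℂ] K) → ℂ} (hφ : IsNormal φ) (c : ℂ) :
    IsNormal fun x => c * φ x := by
  obtain ⟨ξ, η, hξ, hη, h⟩ := hφ
  refine ⟨fun n => c • ξ n, η, ?_, hη, fun x => ?_⟩
  · simpa [norm_smul, mul_pow] using hξ.mul_left (‖c‖ ^ 2)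
  · simpa [inner_smul_right] using (h x).mul_left c

theorem isNormal_zero : IsNormal fun _ : K →L[ℂ] K => 0 := by
  simpa using isNormal_vector (0 : K) 0

theorem IsNormal.sum {ι : Type*} (s : Finset ι) {φ : ι → (K →L[ℂ] K) → ℂ}
    (hφ : ∀ i ∈ s, IsNormal (φ i)) : IsNormal fun x => ∑ i ∈ s, φ i x := by
  classical
  induction s using Finset.induction_on with
  | empty => simpa using isNormal_zero
  | insert i s hi ih =>
    simp only [Finset.sum_insert hi]
    exact (hφ i (by simp)).add (ih fun j hj => hφ j (by simp [hj]))

variable [CompleteSpace K] [CompleteSpace L]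

theorem IsNormal.star {φ : (K →L[ℂ] K) → ℂ} (hφ : IsNormal φ) :
    IsNormal fun x => conj (φ (star x)) := by
  obtain ⟨ξ, η, hξ, hη, h⟩ := hφ
  refine ⟨η, ξ, hη, hξ, fun x => ?_⟩
  have := (h (Star.star x)).map (starRingEnd ℂ) Complex.continuous_conj
  convert this using 2 with n
  simp [ContinuousLinearMap.star_eq_adjoint, ContinuousLinearMap.adjoint_inner_right]

/-- Precomposing a normal functional with `y ↦ P y Q`. -/
theorem IsNormal.comp {φ : (K →L[ℂ] K) → ℂ} (hφ : IsNormal φ) (P : L →L[ℂ] K) (Q : K →L[ℂ] L) :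
    IsNormal fun y : L →L[ℂ] L => φ (P ∘L y ∘L Q) := by
  obtain ⟨ξ, η, hξ, hη, h⟩ := hφ
  refine ⟨fun n => Q (ξ n), fun n => (P†) (η n), ?_, ?_, fun y => ?_⟩
  · refine (hξ.mul_left (‖Q‖ ^ 2)).of_nonneg_of_le (fun n => by positivity) fun n => ?_
    rw [← mul_pow]; gcongr; exact Q.le_opNorm _
  · refine (hη.mul_left (‖P†‖ ^ 2)).of_nonneg_of_le (fun n => by positivity) fun n => ?_
    rw [← mul_pow]; gcongr; exact (P†).le_opNorm _
  · simpa [ContinuousLinearMap.adjoint_inner_left] using h (P ∘L y ∘L Q)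

/-- Bessel's inequality bounds each inner sum by ‖ξ n‖². This supplies the absolute convergence for
the exchange of sums below. -/
theorem Orthonormal.summable_sq_inner {ι : Type*} {b : ι → K} (hb : Orthonormal ℂ b) {ξ : ℕ → K}
    (hξ : Summable fun n => ‖ξ n‖ ^ 2) : Summable fun p : ℕ × ι => ‖⟪b p.2, ξ p.1⟫_ℂ‖ ^ 2 := by
  rw [summable_prod_of_nonneg (fun _ => by positivity)]
  refine ⟨fun n => hb.inner_products_summable (ξ n), ?_⟩
  exact hξ.of_nonneg_of_le (fun n => tsum_nonneg fun _ => by positivity)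
    fun n => hb.tsum_inner_products_le (ξ n)

/-- Parseval's identity expands each term along the basis, and Fubini lets the sum over n be taken
before the sum over i. -/
theorem tsum_inner_eq_zero_of_basis {ι : Type*} (b : HilbertBasis ι ℂ K) {ξ η : ℕ → K}
    (hξ : Summable fun n => ‖ξ n‖ ^ 2) (hη : Summable fun n => ‖η n‖ ^ 2)
    (h : ∀ i, ∑' n, ⟪η n, b i⟫_ℂ * ⟪b i, ξ n⟫_ℂ = 0) : ∑' n, ⟪η n, ξ n⟫_ℂ = 0 := by
  have hs : Summable fun p : ℕ × ι => ⟪η p.1, b p.2⟫_ℂ * ⟪b p.2, ξ p.1⟫_ℂ := by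
    refine Summable.of_norm_bounded (summable_mul_of_sq
      (Orthonormal.summable_sq_inner b.orthonormal hη)
      (Orthonormal.summable_sq_inner b.orthonormal hξ)) fun p => ?_
    rw [norm_mul, norm_inner_symm]
  have h1 : ∀ n, ∑' i, ⟪η n, b i⟫_ℂ * ⟪b i, ξ n⟫_ℂ = ⟪η n, ξ n⟫_ℂ := fun n =>
    b.tsum_inner_mul_inner _ _
  calc ∑' n, ⟪η n, ξ n⟫_ℂ = ∑' n, ∑' i, ⟪η n, b i⟫_ℂ * ⟪b i, ξ n⟫_ℂ := by simp_rw [h1]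
    _ = ∑' i, ∑' n, ⟪η n, b i⟫_ℂ * ⟪b i, ξ n⟫_ℂ := by
      exact (Summable.tsum_comm (f := fun n i => ⟪η n, b i⟫_ℂ * ⟪b i, ξ n⟫_ℂ) hs).symm
    _ = 0 := by simp [h]

/-- A normal functional vanishing on operators of rank one is zero. -/
theorem IsNormal.eq_zero_of_rankOne {φ : (K →L[ℂ] K) → ℂ} (hφ : IsNormal φ)
    (h : ∀ p q, φ (InnerProductSpace.rankOne ℂ p q) = 0) (x : K →L[ℂ] K) : φ x = 0 := by
  obtain ⟨ξ, η, hξ, hη, hφ⟩ := hφ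
  obtain ⟨ι, b, -⟩ := exists_hilbertBasis ℂ K
  have hη' : Summable fun n => ‖(x†) (η n)‖ ^ 2 := by
    refine (hη.mul_left (‖x†‖ ^ 2)).of_nonneg_of_le (fun n => by positivity) fun n => ?_
    rw [← mul_pow]; gcongr; exact (x†).le_opNorm _
  -- With x*η in place of η, the sum over n attached to the basis vector b i is the value of φ on
  -- the rank one operator z ↦ ⟨b i, z⟩ x(b i).
  have := tsum_inner_eq_zero_of_basis b hξ hη' fun i => by
    rw [← h (x (b i)) (b i), ← (hφ _).tsum_eq]
    refine tsum_congr fun n => ?_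
    rw [InnerProductSpace.rankOne_apply, inner_smul_right, ContinuousLinearMap.adjoint_inner_left,
      mul_comm]
  rw [← (hφ x).tsum_eq, ← this]
  exact tsum_congr fun n => (ContinuousLinearMap.adjoint_inner_left _ _ _).symm

/-- A normal functional on `B(L ⊗ K)` vanishing on all `a ⊗ b` is zero. -/
theorem IsNormal.eq_zero_of_mapH {φ : (HTensor L K →L[ℂ] HTensor L K) → ℂ} (hφ : IsNormal φ)
    (h : ∀ a b, φ (mapH a b) = 0) (x : HTensor L K →L[ℂ] HTensor L K) : φ x = 0 := by
  obtain ⟨ω, -, hω⟩ := hφ.exists_mem_predual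
  refine hφ.eq_zero_of_rankOne (fun p q => ?_) x
  -- A rank one operator built from elementary tensors is a tensor product of rank one operators.
  -- Norm continuity then extends the vanishing to arbitrary vectors, one slot at a time.
  have h1 : ∀ x y x' y', ω (InnerProductSpace.rankOne ℂ (tmulH x y : HTensor L K) (tmulH x' y')) = 0 := by
    intro x y x' y'
    have : InnerProductSpace.rankOne ℂ (tmulH x y : HTensor L K) (tmulH x' y') =
        mapH (InnerProductSpace.rankOne ℂ x x') (InnerProductSpace.rankOne ℂ y y') :=
      semilinear_ext fun u v => by
        rw [InnerProductSpace.rankOne_apply, mapH_tmulH, InnerProductSpace.rankOne_apply,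
          InnerProductSpace.rankOne_apply, tmulH_smul_left, tmulH_smul_right, inner_tmulH, mul_smul]
    rw [this, hω, h]
  have h2 : ∀ p x' y', ω (InnerProductSpace.rankOne ℂ (p : HTensor L K) (tmulH x' y')) = 0 := by
    intro p x' y'
    have : ω ∘L (InnerProductSpace.rankOne ℂ (E := HTensor L K)).flip (tmulH x' y') = 0 :=
      semilinear_ext fun x y => by simpa using h1 x y x' y'
    simpa using DFunLike.congr_fun this p
  have : ω.comp (InnerProductSpace.rankOne ℂ p) = (0 : HTensor L K →L⋆[ℂ] ℂ) :=
    semilinear_ext fun x y => by simpa using h2 p x y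
  rw [← hω]
  simpa using DFunLike.congr_fun this q

/-- The isometry `y ↦ x ⊗ y` for a unit vector `x`. -/
def leftLegIsometry (x : L) (hx : ‖x‖ = 1) : K →ₗᵢ[ℂ] HTensor L K where
  toLinearMap := (leftLeg x : K →L[ℂ] HTensor L K).toLinearMap
  norm_map' y := (norm_tmulH x y).trans (by rw [hx, one_mul])

theorem leftLegIsometry_orthogonalFamily {ι : Type*} {b : ι → L} (hb : Orthonormal ℂ b) :
    OrthogonalFamily ℂ (fun _ : ι => K) fun i => leftLegIsometry (b i) (hb.1 i) :=
  fun i j hij x y => by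
    change ⟪tmulH (b i) x, tmulH (b j) y⟫_ℂ = 0
    rw [inner_tmulH, hb.2 hij, zero_mul]

/-- Expansion of a vector of `L ⊗ K` along a Hilbert basis of `L`. -/
theorem hasSum_leftLeg_basis {ι : Type*} (b : HilbertBasis ι ℂ L) (u : HTensor L K) :
    HasSum (fun i => leftLeg (b i) (((leftLeg (b i) : K →L[ℂ] HTensor L K)†) u)) u ∧
      Summable (fun i => ‖((leftLeg (b i) : K →L[ℂ] HTensor L K)†) u‖ ^ 2) ∧
      ∑' i, ‖((leftLeg (b i) : K →L[ℂ] HTensor L K)†) u‖ ^ 2 = ‖u‖ ^ 2 := by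
  let V : ι → K →ₗᵢ[ℂ] HTensor L K := fun i => leftLegIsometry (b i) (b.orthonormal.1 i)
  have hV : OrthogonalFamily ℂ (fun _ : ι => K) V := leftLegIsometry_orthogonalFamily b.orthonormal
  have hT : ⊤ ≤ (⨆ i, LinearMap.range (V i).toLinearMap).topologicalClosure := by
    intro t _
    refine mem_of_tmulH_mem _ (Submodule.isClosed_topologicalClosure _) (fun x y => ?_) t
    have hx : x ∈ (Submodule.span ℂ (Set.range b)).topologicalClosure := by
      rw [b.dense_span]; trivial
    have hcl : IsClosed ((⨆ i, LinearMap.range (V i).toLinearMap).topologicalClosure.comap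
        ((rightLeg y : L →L[ℂ] HTensor L K) : L →ₗ[ℂ] HTensor L K) : Set L) :=
      (Submodule.isClosed_topologicalClosure _).preimage
        (rightLeg y : L →L[ℂ] HTensor L K).continuous
    refine Submodule.topologicalClosure_minimal _ ?_ hcl hx
    rw [Submodule.span_le]
    rintro _ ⟨i, rfl⟩
    exact Submodule.le_topologicalClosure _ (Submodule.mem_iSup_of_mem i ⟨y, rfl⟩)
  have hS : IsHilbertSum ℂ (fun _ : ι => K) V := IsHilbertSum.mk hV hT
  have h := hS.hasSum_linearIsometryEquiv_symm (hS.linearIsometryEquiv u)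
  rw [LinearIsometryEquiv.symm_apply_apply] at h
  have hc : ∀ i, ((leftLeg (b i) : K →L[ℂ] HTensor L K)†) u = hS.linearIsometryEquiv u i := by
    classical
    intro i
    refine (h.map ((leftLeg (b i) : K →L[ℂ] HTensor L K)†)
      (ContinuousLinearMap.continuous _)).unique ?_
    convert hasSum_ite_eq i (hS.linearIsometryEquiv u i) using 2 with j
    change ((leftLeg (b i) : K →L[ℂ] HTensor L K)†) (tmulH (b j) _) = _
    rw [adjoint_leftLeg_apply, orthonormal_iff_ite.1 b.orthonormal]
    split_ifs with h1 h2 h2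
    · subst h1; simp
    · exact absurd h1.symm h2
    · exact absurd h2.symm h1
    · simp
  simp_rw [hc]
  refine ⟨h, ?_, ?_⟩
  · simpa using (lp.memℓp (hS.linearIsometryEquiv u)).summable (by norm_num)
  · have := lp.norm_rpow_eq_tsum (p := 2) (by norm_num) (hS.linearIsometryEquiv u)
    simpa using this.symm

/-- If `φ` is normal on `B(L ⊗ K)` then `x ↦ φ (1 ⊗ x)` is normal. -/
theorem IsNormal.amplify {φ : (HTensor L K →L[ℂ] HTensor L K) → ℂ} (hφ : IsNormal φ) :
    IsNormal fun x : K →L[ℂ] K => φ (mapH (.id ℂ L) x) := by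
  obtain ⟨ξ, η, hξ, hη, h⟩ := hφ
  obtain ⟨ι, b, -⟩ := exists_hilbertBasis ℂ L
  -- Each vector is replaced by its coefficients along a basis of L, so the new family is indexed by
  -- ℕ × ι. The squared norms of the coefficients of ξ n add up to ‖ξ n‖².
  have hs : ∀ {ξ : ℕ → HTensor L K}, (Summable fun n => ‖ξ n‖ ^ 2) → Summable fun p : ℕ × ι =>
      ‖((leftLeg (b p.2) : K →L[ℂ] HTensor L K)†) (ξ p.1)‖ ^ 2 := by
    intro ξ hξ
    rw [summable_prod_of_nonneg (fun _ => by positivity)]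
    refine ⟨fun n => (hasSum_leftLeg_basis b (ξ n)).2.1, ?_⟩
    simpa [(hasSum_leftLeg_basis b (ξ _)).2.2] using hξ
  refine IsNormal.of_hasSum _ _ (hs hξ) (hs hη) fun x => ?_
  have h1 : ∀ n, HasSum (fun i => ⟪((leftLeg (b i) : K →L[ℂ] HTensor L K)†) (η n),
      x (((leftLeg (b i) : K →L[ℂ] HTensor L K)†) (ξ n))⟫_ℂ)
      ⟪η n, mapH (.id ℂ L) x (ξ n)⟫_ℂ := by
    intro n
    have := (hasSum_leftLeg_basis b (ξ n)).1.map (innerSL ℂ (η n) ∘L mapH (.id ℂ L) x)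
      (ContinuousLinearMap.continuous _)
    convert this using 2 with i
    · simp [ContinuousLinearMap.adjoint_inner_left]
    · rfl
  have hsum : Summable fun p : ℕ × ι => ⟪((leftLeg (b p.2) : K →L[ℂ] HTensor L K)†) (η p.1),
      x (((leftLeg (b p.2) : K →L[ℂ] HTensor L K)†) (ξ p.1))⟫_ℂ := by
    refine Summable.of_norm_bounded ((summable_mul_of_sq (hs hη) (hs hξ)).mul_left ‖x‖) fun p => ?_
    refine (norm_inner_le_norm _ _).trans ?_
    have := x.le_opNorm (((leftLeg (b p.2) : K →L[ℂ] HTensor L K)†) (ξ p.1))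
    calc _ ≤ _ := mul_le_mul_of_nonneg_left this (norm_nonneg _)
      _ = _ := by ring
  have h2 := hsum.hasSum.prod_fiberwise h1
  rw [← h2.unique (h (mapH (.id ℂ L) x))]
  exact hsum.hasSum

/-- If `φ` is normal on `B(K ⊗ L)` then `x ↦ φ (x ⊗ 1)` is normal. -/
theorem IsNormal.amplify_right {φ : (HTensor K L →L[ℂ] HTensor K L) → ℂ} (hφ : IsNormal φ) :
    IsNormal fun x : K →L[ℂ] K => φ (mapH x (.id ℂ L)) := by
  have := (hφ.comp (L := HTensor L K) flipH flipH).amplify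
  convert this using 3 with x
  exact semilinear_ext fun a b => by simp

variable [CompleteSpace H]

theorem IsNormal.leg23 {φ : (HTensor H (HTensor H H) →L[ℂ] HTensor H (HTensor H H)) → ℂ}
    (hφ : IsNormal φ) : IsNormal fun x : HTensor H H →L[ℂ] HTensor H H => φ (leg23 x) :=
  hφ.amplify

theorem IsNormal.leg12 {φ : (HTensor H (HTensor H H) →L[ℂ] HTensor H (HTensor H H)) → ℂ}
    (hφ : IsNormal φ) : IsNormal fun x : HTensor H H →L[ℂ] HTensor H H => φ (leg12 x) :=
  (hφ.comp (assocH H H H : HTensor (HTensor H H) H →L[ℂ] HTensor H (HTensor H H))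
    ((assocH H H H).symm : HTensor H (HTensor H H) →L[ℂ] HTensor (HTensor H H) H)).amplify_right

theorem IsNormal.leg13 {φ : (HTensor H (HTensor H H) →L[ℂ] HTensor H (HTensor H H)) → ℂ}
    (hφ : IsNormal φ) : IsNormal fun x : HTensor H H →L[ℂ] HTensor H H => φ (leg13 x) :=
  (hφ.comp (QGF.leg23 flipH) (QGF.leg23 flipH)).leg12

end Normal

/-! ### The `σ`-weak topology, normal slices and the double commutant theorem -/

section SigmaWeak

variable {H : Type u} [NormedAddCommGroup H] [InnerProductSpace ℂ H]

theorem sum_smul_mem_predual {ι : Type*} (s : Finset ι) (c : ι → ℂ)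
    {ω : ι → StrongDual ℂ (H →L[ℂ] H)} (h : ∀ i ∈ s, ω i ∈ predual H) :
    ∑ i ∈ s, c i • ω i ∈ predual H := by
  have := IsNormal.sum s (φ := fun i x => c i * ω i x)
    fun i hi => (isNormal_of_mem_predual (h i hi)).smul (c i)
  change IsNormal fun x => (∑ i ∈ s, c i • ω i) x
  simpa using this

/-- The bipolar theorem for subspaces in the `σ`-weak topology. -/
theorem mem_sigmaWeakClosure_iff (A : Submodule ℂ (H →L[ℂ] H)) (x : H →L[ℂ] H) :
    x ∈ sigmaWeakClosure (A : Set (H →L[ℂ] H)) ↔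
      ∀ ω ∈ predual H, (∀ a ∈ A, ω a = 0) → ω x = 0 := by
  classical
  let Φ : (H →L[ℂ] H) → (predual H → ℂ) := fun x ω => (ω : StrongDual ℂ (H →L[ℂ] H)) x
  have key : x ∈ sigmaWeakClosure (A : Set (H →L[ℂ] H)) ↔ Φ x ∈ closure (Φ '' A) :=
    closure_induced
  rw [key]
  constructor
  · intro hx ω hω h
    have hcl : IsClosed {g : predual H → ℂ | g ⟨ω, hω⟩ = 0} :=
      isClosed_eq (continuous_apply _) continuous_const
    refine closure_minimal ?_ hcl hx
    rintro _ ⟨a, ha, rfl⟩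
    exact h a ha
  · intro h
    rw [mem_closure_iff]
    intro o ho hxo
    -- A basic neighbourhood involves only finitely many functionals, so it is enough to find an
    -- element of A agreeing with x on all of them.
    obtain ⟨I, u, hu, hI⟩ := isOpen_pi_iff.1 ho _ hxo
    let Ψ : (H →L[ℂ] H) →ₗ[ℂ] (I → ℂ) :=
      LinearMap.pi fun i => ((i : predual H) : StrongDual ℂ (H →L[ℂ] H)).toLinearMap
    have hmem : Ψ x ∈ A.map Ψ := by
      by_contra hx
      -- Otherwise a linear form f on the finite-dimensional quotient data separates; its
      -- coordinates are the coefficients of a predual element vanishing on A but not at x.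
      obtain ⟨f, hf, hfA⟩ := Submodule.exists_le_ker_of_notMem hx
      have hfs : ∀ g : I → ℂ, f g = ∑ i, f (Pi.single i 1) * g i := fun g => by
        conv_lhs => rw [← Finset.univ_sum_single g]
        rw [map_sum]
        refine Finset.sum_congr rfl fun i _ => ?_
        rw [← mul_one (g i), ← smul_eq_mul, Pi.single_smul, map_smul]
        simp [mul_comm]
      have h0 := h (∑ i : I, f (Pi.single i 1) • ((i : predual H) : StrongDual ℂ (H →L[ℂ] H)))
        (sum_smul_mem_predual _ _ fun i _ => (i : predual H).2) (fun a ha => by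
          have : f (Ψ a) = 0 := hfA ⟨a, ha, rfl⟩
          rw [hfs] at this
          simpa [Ψ] using this)
      apply hf
      rw [hfs]
      simpa [Ψ] using h0
    obtain ⟨a, ha, hax⟩ := hmem
    refine ⟨Φ a, hI fun i hi => ?_, a, ha, rfl⟩
    have : Φ a i = Φ x i := congrFun hax ⟨i, hi⟩
    rw [this]
    exact (hu i hi).2

variable [CompleteSpace H]

section Slices

variable {K : Type*} [NormedAddCommGroup K] [InnerProductSpace ℂ K] [CompleteSpace K]

theorem sliceAlong_add (L : H →L[ℂ] H →L[ℂ] K) (T : K →L[ℂ] K) (ω ω' : StrongDual ℂ (H →L[ℂ] H)) :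
    sliceAlong L T (ω + ω') = sliceAlong L T ω + sliceAlong L T ω' := by
  ext x
  refine ext_inner_left ℂ fun y => ?_
  simp [inner_sliceAlong, inner_add_right]

theorem sliceAlong_smul (L : H →L[ℂ] H →L[ℂ] K) (T : K →L[ℂ] K) (c : ℂ)
    (ω : StrongDual ℂ (H →L[ℂ] H)) : sliceAlong L T (c • ω) = c • sliceAlong L T ω := by
  ext x
  refine ext_inner_left ℂ fun y => ?_
  simp [inner_sliceAlong, inner_smul_right]

/-- The subspace of all normal slices of `T`. -/
def sliceSubmodule (L : H →L[ℂ] H →L[ℂ] K) (T : K →L[ℂ] K) : Submodule ℂ (H →L[ℂ] H) where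
  carrier := {s | ∃ ω ∈ predual H, sliceAlong L T ω = s}
  add_mem' := by
    rintro _ _ ⟨ω, hω, rfl⟩ ⟨ω', hω', rfl⟩
    exact ⟨ω + ω', (isNormal_of_mem_predual hω).add (isNormal_of_mem_predual hω'),
      sliceAlong_add L T ω ω'⟩
  zero_mem' := ⟨0, isNormal_zero, by
    rw [← zero_smul ℂ (0 : StrongDual ℂ (H →L[ℂ] H)), sliceAlong_smul, zero_smul]⟩
  smul_mem' := by
    rintro c _ ⟨ω, hω, rfl⟩
    exact ⟨c • ω, (isNormal_of_mem_predual hω).smul c, sliceAlong_smul L T c ω⟩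

/-- Slices by vector functionals are explicit compressions. For L = `leftLeg` the flipped map is
`rightLeg`, and conversely. -/
theorem vector_slice_mem (L : H →L[ℂ] H →L[ℂ] K) (T : K →L[ℂ] K) (p q : H) :
    (L.flip p)† ∘L T ∘L L.flip q ∈ sliceSubmodule L T := by
  obtain ⟨ω, hω, h⟩ := (isNormal_vector p q).exists_mem_predual
  refine ⟨ω, hω, ?_⟩
  ext x
  refine ext_inner_left ℂ fun y => ?_
  rw [inner_sliceAlong, h]
  simp [ContinuousLinearMap.adjoint_inner_right]

/-- A normal functional vanishing on all slices by vector functionals vanishes on all slices by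
normal functionals. -/
theorem IsNormal.eq_zero_on_slices {φ : (H →L[ℂ] H) → ℂ} (hφ : IsNormal φ)
    {L : H →L[ℂ] H →L[ℂ] K} {T : K →L[ℂ] K}
    (h : ∀ p q, φ ((L.flip p)† ∘L T ∘L L.flip q) = 0) {s : H →L[ℂ] H}
    (hs : s ∈ sliceSubmodule L T) : φ s = 0 := by
  obtain ⟨ω, ⟨ξ, η, hξ, hη, hω⟩, rfl⟩ := hs
  obtain ⟨ζ, θ, hζ, hθ, hφ⟩ := hφ
  have h1 : ∀ m, ∑' n, ⟪L (θ m) (η n), T (L (ζ m) (ξ n))⟫_ℂ = ⟪θ m, sliceAlong L T ω (ζ m)⟫_ℂ := by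
    intro m
    rw [inner_sliceAlong, ← (hω _).tsum_eq]
    exact tsum_congr fun n => (ContinuousLinearMap.adjoint_inner_right _ _ _).symm
  have h2 : ∀ n, ∑' m, ⟪L (θ m) (η n), T (L (ζ m) (ξ n))⟫_ℂ = 0 := by
    intro n
    rw [← h (η n) (ξ n), ← (hφ _).tsum_eq]
    refine tsum_congr fun m => ?_
    rw [ContinuousLinearMap.comp_apply, ContinuousLinearMap.adjoint_inner_right]
    rfl
  -- This is the identity φ((ι ⊗ ω)(T)) = ω((φ ⊗ ι)(T)) written as a double series; absolute
  -- convergence permits summing over m first, where each sum is φ of a vector slice.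
  have hsum : Summable fun p : ℕ × ℕ => ⟪L (θ p.1) (η p.2), T (L (ζ p.1) (ξ p.2))⟫_ℂ := by
    refine Summable.of_norm_bounded (((summable_mul_of_sq hθ hζ).mul_of_nonneg
      (summable_mul_of_sq hη hξ) (fun _ => by positivity) (fun _ => by positivity)).mul_left
      (‖L‖ * ‖T‖ * ‖L‖)) fun p => ?_
    calc ‖⟪L (θ p.1) (η p.2), T (L (ζ p.1) (ξ p.2))⟫_ℂ‖
        ≤ ‖L (θ p.1) (η p.2)‖ * ‖T (L (ζ p.1) (ξ p.2))‖ := norm_inner_le_norm _ _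
      _ ≤ (‖L‖ * ‖θ p.1‖ * ‖η p.2‖) * (‖T‖ * (‖L‖ * ‖ζ p.1‖ * ‖ξ p.2‖)) := by
        gcongr
        · exact L.le_opNorm₂ _ _
        · exact (T.le_opNorm _).trans (by gcongr; exact L.le_opNorm₂ _ _)
      _ = _ := by ring
  rw [← (hφ _).tsum_eq]
  simp_rw [← h1]
  rw [← Summable.tsum_comm (f := fun m n => ⟪L (θ m) (η n), T (L (ζ m) (ξ n))⟫_ℂ) hsum]
  simp [h2]

end Slices

/-- A normal functional is a vector functional of an amplification. -/
theorem IsNormal.exists_vectors {φ : (H →L[ℂ] H) → ℂ} (hφ : IsNormal φ) :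
    ∃ u v : HTensor (lp (fun _ : ℕ => ℂ) 2) H, ∀ x, φ x = ⟪v, mapH (.id ℂ _) x u⟫_ℂ := by
  obtain ⟨ξ, η, hξ, hη, h⟩ := hφ
  let b : HilbertBasis ℕ ℂ (lp (fun _ : ℕ => ℂ) 2) := ⟨LinearIsometryEquiv.refl ℂ _⟩
  have hs : ∀ {ξ : ℕ → H}, (Summable fun n => ‖ξ n‖ ^ 2) → Summable fun n => tmulH (b n) (ξ n) := by
    intro ξ hξ
    have := ((leftLegIsometry_orthogonalFamily b.orthonormal).summable_iff_norm_sq_summable ξ).2 hξ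
    exact this
  refine ⟨∑' n, tmulH (b n) (ξ n), ∑' n, tmulH (b n) (η n), fun x => ?_⟩
  have h1 : ∀ n y, ⟪∑' n, tmulH (b n) (η n), tmulH (b n) y⟫_ℂ = ⟪η n, y⟫_ℂ := by
    intro n y
    have h2 := (hs hη).hasSum.map ((leftLeg (b n) : H →L[ℂ] HTensor _ H)†)
      (ContinuousLinearMap.continuous _)
    have h3 : ((leftLeg (b n) : H →L[ℂ] HTensor _ H)†) (∑' n, tmulH (b n) (η n)) = η n := by
      refine h2.unique ?_
      convert hasSum_ite_eq n (η n) using 2 with j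
      rw [Function.comp_apply, adjoint_leftLeg_apply, orthonormal_iff_ite.1 b.orthonormal]
      split_ifs with h1 h2 h2
      · subst h1; simp
      · exact absurd h1.symm h2
      · exact absurd h2.symm h1
      · simp
    rw [← leftLeg_apply, ← ContinuousLinearMap.adjoint_inner_left, h3]
  have h4 := (hs hξ).hasSum.map (innerSL ℂ (∑' n, tmulH (b n) (η n)) ∘L mapH (.id ℂ _) x)
      (ContinuousLinearMap.continuous _)
  refine (h x).unique ?_
  convert h4 using 2 with n
  · simp [h1]
  · rfl

section Amplification

variable {L : Type*} [NormedAddCommGroup L] [InnerProductSpace ℂ L] [CompleteSpace L]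

theorem mapH_id_mul (a b : H →L[ℂ] H) (t : HTensor L H) :
    mapH (.id ℂ L) (a * b) t = mapH (.id ℂ L) a (mapH (.id ℂ L) b t) := by
  have : mapH (.id ℂ L) (a * b) = mapH (.id ℂ L) a ∘L mapH (.id ℂ L) b :=
    semilinear_ext fun x y => by simp
  rw [this, ContinuousLinearMap.comp_apply]

theorem inner_mapH_id_left (a : H →L[ℂ] H) (s t : HTensor L H) :
    ⟪mapH (.id ℂ L) (star a) s, t⟫_ℂ = ⟪s, mapH (.id ℂ L) a t⟫_ℂ := by
  rw [ContinuousLinearMap.star_eq_adjoint, ← ContinuousLinearMap.adjoint_inner_left, adjoint_mapH,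
    ContinuousLinearMap.adjoint_id]

theorem adjoint_leftLeg_mapH_id (l : L) (a : H →L[ℂ] H) (t : HTensor L H) :
    ((leftLeg l : H →L[ℂ] HTensor L H)†) (mapH (.id ℂ L) a t) =
      a (((leftLeg l : H →L[ℂ] HTensor L H)†) t) := by
  have := DFunLike.congr_fun (adjoint_leftLeg_comp_mapH l (.id ℂ L) a) t
  rwa [ContinuousLinearMap.adjoint_id, ContinuousLinearMap.comp_apply,
    ContinuousLinearMap.comp_apply, ContinuousLinearMap.id_apply] at this

/-- An operator commuting with the amplification of a set of operators commutes with the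
amplification of its bicommutant. -/
theorem commute_amplification_of_bicommutant {A : Set (H →L[ℂ] H)} {x : H →L[ℂ] H}
    (hx : x ∈ Set.centralizer (Set.centralizer A)) (P : HTensor L H →L[ℂ] HTensor L H)
    (hP : ∀ a ∈ A, ∀ t, P (mapH (.id ℂ L) a t) = mapH (.id ℂ L) a (P t)) (t : HTensor L H) :
    P (mapH (.id ℂ L) x t) = mapH (.id ℂ L) x (P t) := by
  -- The matrix coefficients of P along the first factor lie in the commutant of A, hence commute
  -- with x; these coefficients determine P.
  have hQ : ∀ l l', (leftLeg l)† ∘L P ∘L leftLeg l' ∈ Set.centralizer A := by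
    intro l l' a ha
    ext h
    have h3 := hP a ha (tmulH l' h)
    rw [mapH_tmulH, ContinuousLinearMap.id_apply] at h3
    simp only [ContinuousLinearMap.comp_apply, mul_apply_eq_comp, leftLeg_apply]
    rw [← adjoint_leftLeg_mapH_id, h3]
  have : P ∘L mapH (.id ℂ L) x = mapH (.id ℂ L) x ∘L P := by
    refine semilinear_ext fun l' h' => eq_of_inner_tmulH fun l h => ?_
    have h1 := DFunLike.congr_fun (hx _ (hQ l l')) h'
    simp only [ContinuousLinearMap.comp_apply, mul_apply_eq_comp, leftLeg_apply] at h1 ⊢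
    rw [mapH_tmulH, ContinuousLinearMap.id_apply, ← leftLeg_apply l h,
      ← ContinuousLinearMap.adjoint_inner_right, h1, ← adjoint_leftLeg_mapH_id,
      ContinuousLinearMap.adjoint_inner_right]
  exact DFunLike.congr_fun this t

/-- The orthogonal projection onto an invariant closed subspace of an amplification. -/
theorem starProjection_commute_amplification {A : Set (H →L[ℂ] H)} (hstar : ∀ a ∈ A, star a ∈ A)
    (E : Submodule ℂ (HTensor L H)) [E.HasOrthogonalProjection]
    (hE : ∀ a ∈ A, ∀ t ∈ E, mapH (.id ℂ L) a t ∈ E) (a : H →L[ℂ] H) (ha : a ∈ A)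
    (t : HTensor L H) :
    E.starProjection (mapH (.id ℂ L) a t) = mapH (.id ℂ L) a (E.starProjection t) := by
  refine Submodule.eq_starProjection_of_mem_orthogonal
    (hE a ha _ (Submodule.starProjection_apply_mem _ _)) ?_
  rw [← map_sub]
  intro s hs
  rw [← inner_mapH_id_left]
  exact Submodule.sub_starProjection_mem_orthogonal t _ (hE _ (hstar a ha) s hs)

/-- The closed subspace generated by a vector under the amplification of a space of operators. -/
def cyclicSubspace (A : Submodule ℂ (H →L[ℂ] H)) (u : HTensor L H) : Submodule ℂ (HTensor L H) :=
  Submodule.topologicalClosure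
    { carrier := {t | ∃ a ∈ A, mapH (.id ℂ L) a u = t}
      add_mem' := by
        rintro _ _ ⟨a, ha, rfl⟩ ⟨b, hb, rfl⟩
        exact ⟨a + b, A.add_mem ha hb, by rw [mapH_add_right, add_apply]⟩
      zero_mem' := ⟨0, A.zero_mem, by
        rw [← zero_smul ℂ (0 : H →L[ℂ] H), mapH_smul_right, zero_smul, zero_apply]⟩
      smul_mem' := by
        rintro c _ ⟨a, ha, rfl⟩
        exact ⟨c • a, A.smul_mem c ha, by rw [mapH_smul_right, smul_apply]⟩ }

theorem isClosed_cyclicSubspace (A : Submodule ℂ (H →L[ℂ] H)) (u : HTensor L H) :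
    IsClosed (cyclicSubspace A u : Set (HTensor L H)) :=
  Submodule.isClosed_topologicalClosure _

theorem mem_cyclicSubspace {A : Submodule ℂ (H →L[ℂ] H)} (u : HTensor L H) {a : H →L[ℂ] H}
    (ha : a ∈ A) : mapH (.id ℂ L) a u ∈ cyclicSubspace A u :=
  Submodule.le_topologicalClosure _ ⟨a, ha, rfl⟩

theorem cyclicSubspace_le {A : Submodule ℂ (H →L[ℂ] H)} {u : HTensor L H}
    {F : Submodule ℂ (HTensor L H)} (hF : IsClosed (F : Set (HTensor L H)))
    (h : ∀ a ∈ A, mapH (.id ℂ L) a u ∈ F) : cyclicSubspace A u ≤ F := by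
  refine Submodule.topologicalClosure_minimal _ ?_ hF
  rintro _ ⟨a, ha, rfl⟩
  exact h a ha

/-- A vector functional of an amplification vanishing on a nondegenerate `*`-algebra vanishes on
its bicommutant. -/
theorem inner_amplification_eq_zero {A : Submodule ℂ (H →L[ℂ] H)}
    (hmul : ∀ a ∈ A, ∀ b ∈ A, a * b ∈ A) (hstar : ∀ a ∈ A, star a ∈ A)
    (hnd : ∀ h : H, (∀ a ∈ A, a h = 0) → h = 0) {x : H →L[ℂ] H}
    (hx : x ∈ Set.centralizer (Set.centralizer (A : Set (H →L[ℂ] H))))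
    (u v : HTensor L H) (h0 : ∀ a ∈ A, ⟪v, mapH (.id ℂ L) a u⟫_ℂ = 0) :
    ⟪v, mapH (.id ℂ L) x u⟫_ℂ = 0 := by
  have : CompleteSpace (cyclicSubspace A u) := (isClosed_cyclicSubspace A u).completeSpace_coe
  have hE : ∀ a ∈ A, ∀ t ∈ cyclicSubspace A u, mapH (.id ℂ L) a t ∈ cyclicSubspace A u := by
    intro a ha t ht
    have hle : cyclicSubspace A u ≤
        (cyclicSubspace A u).comap ((mapH (.id ℂ L) a : HTensor L H →L[ℂ] HTensor L H) :
          HTensor L H →ₗ[ℂ] HTensor L H) := by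
      refine cyclicSubspace_le
        ((isClosed_cyclicSubspace A u).preimage (mapH (.id ℂ L) a).continuous) fun b hb => ?_
      rw [Submodule.mem_comap, ContinuousLinearMap.coe_coe, ← mapH_id_mul]
      exact mem_cyclicSubspace u (hmul a ha b hb)
    exact hle ht
  have hP := starProjection_commute_amplification (A := (A : Set (H →L[ℂ] H))) hstar
    (cyclicSubspace A u) hE
  have hPx := commute_amplification_of_bicommutant hx _ hP
  -- Without a unit in A, nondegeneracy is what puts u in its own cyclic subspace: P fixes each (1 ⊗
  -- a)u and commutes with 1 ⊗ a, so every slice of Pu - u is killed by A.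
  have hu : (cyclicSubspace A u).starProjection u = u := by
    rw [← sub_eq_zero]
    refine eq_zero_of_inner_tmulH fun l h => ?_
    rw [← leftLeg_apply, ← ContinuousLinearMap.adjoint_inner_right]
    suffices h : ((leftLeg l : H →L[ℂ] HTensor L H)†)
        ((cyclicSubspace A u).starProjection u - u) = 0 by rw [h, inner_zero_right]
    refine hnd _ fun a ha => ?_
    rw [← adjoint_leftLeg_mapH_id, map_sub, ← hP a ha,
      Submodule.starProjection_eq_self_iff.2 (mem_cyclicSubspace u ha), sub_self, map_zero]
  have hxu : mapH (.id ℂ L) x u ∈ cyclicSubspace A u := by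
    have h := hPx u
    rw [hu] at h
    exact Submodule.starProjection_eq_self_iff.1 h
  have hv : cyclicSubspace A u ≤ (Submodule.span ℂ {v})ᗮ :=
    cyclicSubspace_le (Submodule.isClosed_orthogonal _) fun a ha =>
      Submodule.mem_orthogonal_singleton_iff_inner_right.2 (h0 a ha)
  exact Submodule.mem_orthogonal_singleton_iff_inner_right.1 (hv hxu)

end Amplification

/-- The double commutant theorem, in dual form: a normal functional vanishing on a nondegenerate
`*`-algebra vanishes on its bicommutant. -/
theorem eq_zero_of_mem_bicommutant {A : Submodule ℂ (H →L[ℂ] H)}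
    (hmul : ∀ a ∈ A, ∀ b ∈ A, a * b ∈ A) (hstar : ∀ a ∈ A, star a ∈ A)
    (hnd : ∀ h : H, (∀ a ∈ A, a h = 0) → h = 0) {x : H →L[ℂ] H}
    (hx : x ∈ Set.centralizer (Set.centralizer (A : Set (H →L[ℂ] H))))
    {φ : (H →L[ℂ] H) → ℂ} (hφ : IsNormal φ) (h0 : ∀ a ∈ A, φ a = 0) : φ x = 0 := by
  obtain ⟨u, v, huv⟩ := hφ.exists_vectors
  rw [huv]
  exact inner_amplification_eq_zero hmul hstar hnd hx u v fun a ha => by rw [← huv, h0 a ha]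

end SigmaWeak

/-! ### Tensor products of antiunitary involutions and conjugation by them -/

namespace AntiunitaryInvolution

section Prod

variable {E F : Type u} [NormedAddCommGroup E] [InnerProductSpace ℂ E]
  [NormedAddCommGroup F] [InnerProductSpace ℂ F]

@[simp] theorem toCLM_apply (J : AntiunitaryInvolution E) (x : E) : J.toCLM x = J.toFun x := rfl

theorem inner_map_tensorProduct (J : AntiunitaryInvolution E) (K : AntiunitaryInvolution F)
    (s t : E ⊗[ℂ] F) :
    ⟪TensorProduct.map J.toFun K.toFun s, TensorProduct.map J.toFun K.toFun t⟫_ℂ = ⟪t, s⟫_ℂ := by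
  induction s with
  | zero => simp
  | add s s' hs hs' => simp [inner_add_left, inner_add_right, hs, hs']
  | tmul x y =>
    induction t with
    | zero => simp
    | add t t' ht ht' => rw [map_add, inner_add_left, inner_add_right, ht, ht']
    | tmul x' y' => simp [inner_map_map]

/-- The tensor product of antiunitary involutions on possibly different spaces. -/
def tensorMap (J : AntiunitaryInvolution E) (K : AntiunitaryInvolution F) :
    HTensor E F →L⋆[ℂ] HTensor E F :=
  extendH ((TensorProduct.map J.toFun K.toFun).mkContinuous 1 fun t => by
    rw [one_mul, @norm_eq_sqrt_re_inner ℂ, @norm_eq_sqrt_re_inner ℂ _ _ _ _ t,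
      inner_map_tensorProduct])

@[simp] theorem tensorMap_tmulH (J : AntiunitaryInvolution E) (K : AntiunitaryInvolution F)
    (x : E) (y : F) : J.tensorMap K (tmulH x y) = tmulH (J.toFun x) (K.toFun y) := by
  simp [tensorMap, tmulH]

theorem tensorMap_tensorMap (J : AntiunitaryInvolution E) (K : AntiunitaryInvolution F)
    (t : HTensor E F) : J.tensorMap K (J.tensorMap K t) = t := by
  have : (J.tensorMap K).comp (J.tensorMap K) = .id ℂ _ :=
    semilinear_ext fun x y => by simp [involutive]
  exact DFunLike.congr_fun this t

theorem inner_tensorMap_tensorMap (J : AntiunitaryInvolution E) (K : AntiunitaryInvolution F)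
    (s t : HTensor E F) : ⟪J.tensorMap K s, J.tensorMap K t⟫_ℂ = ⟪t, s⟫_ℂ := by
  induction s, t using DenseRange.induction_on₂ (denseRange_emb (E := E) (F := F)) with
  | hp => exact isClosed_eq (by fun_prop) (by fun_prop)
  | h a b =>
    rw [tensorMap, extendH_emb, extendH_emb, LinearIsometry.inner_map_map,
      LinearIsometry.inner_map_map]
    exact inner_map_tensorProduct J K a b

/-- The tensor product of antiunitary involutions. -/
def prod (J : AntiunitaryInvolution E) (K : AntiunitaryInvolution F) :
    AntiunitaryInvolution (HTensor E F) where
  toFun := (J.tensorMap K).toLinearMap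
  selfAdjoint s t := by
    have := J.inner_tensorMap_tensorMap K s (J.tensorMap K t)
    rwa [tensorMap_tensorMap] at this
  involutive := J.tensorMap_tensorMap K

@[simp] theorem prod_toFun_tmulH (J : AntiunitaryInvolution E) (K : AntiunitaryInvolution F)
    (x : E) (y : F) : (J.prod K).toFun (tmulH x y) = tmulH (J.toFun x) (K.toFun y) :=
  J.tensorMap_tmulH K x y

end Prod

section Conjugate

variable {H : Type u} [NormedAddCommGroup H] [InnerProductSpace ℂ H] (J K : AntiunitaryInvolution H)

/-- Unlike `tensor`, `prod` is again an involution and allows different factors, so it can be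
iterated to conjugate operators on three legs. -/
theorem tensor_eq_toCLM : J.tensor K = (J.prod K).toCLM :=
  semilinear_ext fun x y => by simp

@[simp] theorem conjugate_apply (a : H →L[ℂ] H) (x : H) :
    J.conjugate a x = J.toFun (a (J.toFun x)) := rfl

theorem conjugate_mul (a b : H →L[ℂ] H) : J.conjugate (a * b) = J.conjugate a * J.conjugate b := by
  ext x; simp [involutive]

@[simp] theorem conjugate_conjugate (a : H →L[ℂ] H) : J.conjugate (J.conjugate a) = a := by
  ext x; simp [involutive]

theorem conjugate_prod_mapH (a b : H →L[ℂ] H) :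
    (J.prod K).conjugate (mapH a b) = mapH (J.conjugate a) (K.conjugate b) :=
  semilinear_ext fun x y => by simp

theorem prod_assocH (L : AntiunitaryInvolution H) (t : HTensor H H) (z : H) :
    (J.prod (K.prod L)).toFun (assocH H H H (tmulH t z)) =
      assocH H H H (tmulH ((J.prod K).toFun t) (L.toFun z)) := by
  have : (J.prod (K.prod L)).toCLM.comp ((assocH H H H : HTensor (HTensor H H) H →L[ℂ]
      HTensor H (HTensor H H)).comp (rightLeg z)) =
      ((assocH H H H : HTensor (HTensor H H) H →L[ℂ] HTensor H (HTensor H H)).comp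
        (rightLeg (L.toFun z))).comp (J.prod K).toCLM :=
    semilinear_ext fun x y => by simp
  exact DFunLike.congr_fun this t

theorem conjugate_leg12 (L : AntiunitaryInvolution H) (T : HTensor H H →L[ℂ] HTensor H H) :
    (J.prod (K.prod L)).conjugate (leg12 T) = leg12 ((J.prod K).conjugate T) := by
  have h : ∀ t z, (J.prod (K.prod L)).conjugate (leg12 T) (assocH H H H (tmulH t z)) =
      leg12 ((J.prod K).conjugate T) (assocH H H H (tmulH t z)) := fun t z => by
    rw [conjugate_apply, prod_assocH, leg12_apply, prod_assocH, leg12_apply, conjugate_apply,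
      involutive]
  refine semilinear_ext₃ fun x y z => ?_
  rw [← assocH_tmulH]
  exact h _ _

theorem conjugate_leg23 (L : AntiunitaryInvolution H) (T : HTensor H H →L[ℂ] HTensor H H) :
    (J.prod (K.prod L)).conjugate (leg23 T) = leg23 ((K.prod L).conjugate T) :=
  semilinear_ext fun x t => by simp [involutive]

theorem conjugate_flipH : (K.prod K).conjugate flipH = flipH :=
  semilinear_ext fun x t => by simp [involutive]

theorem conjugate_leg13 (T : HTensor H H →L[ℂ] HTensor H H) :
    (J.prod (K.prod K)).conjugate (leg13 T) = leg13 ((J.prod K).conjugate T) := by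
  rw [leg13, conjugate_mul, conjugate_mul, conjugate_leg12, conjugate_leg23, conjugate_flipH, leg13]

variable [CompleteSpace H]

theorem star_conjugate (a : H →L[ℂ] H) : star (J.conjugate a) = J.conjugate (star a) := by
  rw [ContinuousLinearMap.star_eq_adjoint, ContinuousLinearMap.star_eq_adjoint]
  refine ((ContinuousLinearMap.eq_adjoint_iff _ _).2 fun x y => ?_).symm
  rw [conjugate_apply, conjugate_apply, J.selfAdjoint, ContinuousLinearMap.adjoint_inner_right,
    ← inner_conj_symm x, J.selfAdjoint, inner_conj_symm]

/-- The unitary operator `J K`. -/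
def mulUnitary : H →L[ℂ] H := J.toCLM.comp K.toCLM

@[simp] theorem mulUnitary_apply (x : H) : J.mulUnitary K x = J.toFun (K.toFun x) := rfl

theorem mulUnitary_mul : J.mulUnitary K * K.mulUnitary J = 1 := by
  ext x; simp [involutive]

end Conjugate

end AntiunitaryInvolution

/-! ### Consequences of trimness and of the frame axioms -/

section Regularity

variable {H : Type u} [NormedAddCommGroup H] [InnerProductSpace ℂ H] [CompleteSpace H]

theorem IsNormal.mul_mul {K : Type*} [NormedAddCommGroup K] [InnerProductSpace ℂ K]
    [CompleteSpace K] {φ : (K →L[ℂ] K) → ℂ} (hφ : IsNormal φ) (a b : K →L[ℂ] K) :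
    IsNormal fun y => φ (a * y * b) :=
  hφ.comp a b

theorem algS_eq (W : HTensor H H →L[ℂ] HTensor H H) :
    algS W = (sliceSubmodule leftLeg W : Set (H →L[ℂ] H)) := rfl

theorem algShat_eq (W : HTensor H H →L[ℂ] HTensor H H) :
    algShat W = (sliceSubmodule rightLeg W : Set (H →L[ℂ] H)) := rfl

theorem slice_rightLeg_mem_algS (W : HTensor H H →L[ℂ] HTensor H H) (p q : H) :
    (rightLeg p)† ∘L W ∘L rightLeg q ∈ algS W :=
  vector_slice_mem leftLeg W p q

theorem slice_leftLeg_mem_algShat (W : HTensor H H →L[ℂ] HTensor H H) (p q : H) :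
    (leftLeg p)† ∘L W ∘L leftLeg q ∈ algShat W :=
  vector_slice_mem rightLeg W p q

theorem IsNormal.eq_zero_on_algS {φ : (H →L[ℂ] H) → ℂ} (hφ : IsNormal φ)
    {W : HTensor H H →L[ℂ] HTensor H H} (h : ∀ p q, φ ((rightLeg p)† ∘L W ∘L rightLeg q) = 0)
    {s : H →L[ℂ] H} (hs : s ∈ algS W) : φ s = 0 :=
  hφ.eq_zero_on_slices (L := leftLeg) h hs

theorem IsNormal.eq_zero_on_algShat {φ : (H →L[ℂ] H) → ℂ} (hφ : IsNormal φ)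
    {W : HTensor H H →L[ℂ] HTensor H H} (h : ∀ p q, φ ((leftLeg p)† ∘L W ∘L leftLeg q) = 0)
    {s : H →L[ℂ] H} (hs : s ∈ algShat W) : φ s = 0 :=
  hφ.eq_zero_on_slices (L := rightLeg) h hs

theorem star_slice_rightLeg (W : HTensor H H →L[ℂ] HTensor H H) (p q : H) :
    star ((rightLeg p)† ∘L W ∘L rightLeg q) = (rightLeg q)† ∘L star W ∘L rightLeg p := by
  rw [ContinuousLinearMap.star_eq_adjoint, ContinuousLinearMap.star_eq_adjoint,
    ContinuousLinearMap.adjoint_comp, ContinuousLinearMap.adjoint_comp,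
    ContinuousLinearMap.adjoint_adjoint, ContinuousLinearMap.comp_assoc]

theorem star_slice_leftLeg (W : HTensor H H →L[ℂ] HTensor H H) (p q : H) :
    star ((leftLeg p)† ∘L W ∘L leftLeg q) = (leftLeg q)† ∘L star W ∘L leftLeg p := by
  rw [ContinuousLinearMap.star_eq_adjoint, ContinuousLinearMap.star_eq_adjoint,
    ContinuousLinearMap.adjoint_comp, ContinuousLinearMap.adjoint_comp,
    ContinuousLinearMap.adjoint_adjoint, ContinuousLinearMap.comp_assoc]

/-- This is the form in which trimness is used: density becomes a vanishing criterion for normal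
functionals. -/
theorem IsTrim.eq_zero {W : HTensor H H →L[ℂ] HTensor H H} (hW : IsTrim W)
    {φ : (H →L[ℂ] H) → ℂ} (hφ : IsNormal φ)
    (h : ∀ s ∈ algS W, ∀ t ∈ algShat W, φ (s * star t) = 0) (x : H →L[ℂ] H) : φ x = 0 := by
  obtain ⟨ω, hω, hωφ⟩ := hφ.exists_mem_predual
  have hx : x ∈ sigmaWeakClosure (Submodule.span ℂ {x : H →L[ℂ] H | ∃ s ∈ algS W,
      ∃ t ∈ algShat W, x = s * star t} : Set (H →L[ℂ] H)) := by rw [hW]; trivial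
  rw [← hωφ]
  refine (mem_sigmaWeakClosure_iff _ _).1 hx ω hω fun a ha => ?_
  have hle : Submodule.span ℂ {x : H →L[ℂ] H | ∃ s ∈ algS W,
      ∃ t ∈ algShat W, x = s * star t} ≤ LinearMap.ker ω.toLinearMap := by
    rw [Submodule.span_le]
    rintro _ ⟨s, hs, t, ht, rfl⟩
    exact (hωφ _).trans (h s hs t ht)
  exact hle ha

theorem IsTrim.eq_zero_of_slices {W : HTensor H H →L[ℂ] HTensor H H} (hW : IsTrim W)
    {φ : (H →L[ℂ] H) → ℂ} (hφ : IsNormal φ)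
    (h : ∀ s ∈ algS W, ∀ p q, φ (s * ((leftLeg p)† ∘L star W ∘L leftLeg q)) = 0)
    (x : H →L[ℂ] H) : φ x = 0 := by
  refine hW.eq_zero hφ (fun s hs t ht => ?_) x
  have h1 := ((hφ.mul_mul s 1).star).eq_zero_on_algShat (W := W) (fun p q => by
    rw [star_slice_leftLeg, mul_one, h s hs, map_zero]) ht
  simpa using h1

theorem mem_generatedVN_iff {s : Set (H →L[ℂ] H)} {x : H →L[ℂ] H} :
    x ∈ generatedVN s ↔ x ∈ Set.centralizer (Set.centralizer (s ∪ star s)) := by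
  rw [← StarSubalgebra.coe_centralizer_centralizer ℂ s]
  rfl

/-- If `m` commutes with `S` then `m ⊗ 1` commutes with `W`. -/
theorem mapH_mul_comm_of_algS {W : HTensor H H →L[ℂ] HTensor H H} {m : H →L[ℂ] H}
    (h : ∀ s ∈ algS W, s * m = m * s) : W * mapH m (.id ℂ H) = mapH m (.id ℂ H) * W := by
  refine semilinear_ext fun x y => eq_of_inner_tmulH fun x' y' => ?_
  have h1 := DFunLike.congr_fun (h _ (slice_rightLeg_mem_algS W y' y)) x
  have h2 := congrArg (fun z => ⟪x', z⟫_ℂ) h1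
  simp only [mul_apply_eq_comp, ContinuousLinearMap.comp_apply, rightLeg_apply,
    ContinuousLinearMap.adjoint_inner_right] at h2
  rw [mul_apply_eq_comp, mul_apply_eq_comp, mapH_tmulH, ContinuousLinearMap.id_apply, h2,
    ← ContinuousLinearMap.adjoint_inner_left, ← ContinuousLinearMap.adjoint_inner_left (mapH _ _),
    adjoint_mapH, mapH_tmulH, ContinuousLinearMap.adjoint_inner_right, ContinuousLinearMap.adjoint_id,
    rightLeg_apply, ContinuousLinearMap.id_apply]

variable {W : HTensor H H →L[ℂ] HTensor H H} {J Jhat : AntiunitaryInvolution H}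

namespace IsQuantumGroupFrame

theorem star_mul_self (hW : IsQuantumGroupFrame W J Jhat) : star W * W = 1 :=
  Unitary.star_mul_self_of_mem hW.isMultiplicativeUnitary.mem_unitary

theorem mul_star_self (hW : IsQuantumGroupFrame W J Jhat) : W * star W = 1 :=
  Unitary.mul_star_self_of_mem hW.isMultiplicativeUnitary.mem_unitary

theorem star_eq_conjugate (hW : IsQuantumGroupFrame W J Jhat) :
    star W = (Jhat.prod J).conjugate W := by
  rw [hW.star_eq, AntiunitaryInvolution.tensor_eq_toCLM]
  rfl

/-- `W` commutes with `Ĵ J m J Ĵ ⊗ 1` for `m` in `M`. -/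
theorem commute_conjugate (hW : IsQuantumGroupFrame W J Jhat) {m : H →L[ℂ] H} (hm : m ∈ algM W) :
    W * mapH (Jhat.conjugate (J.conjugate m)) (.id ℂ H) =
      mapH (Jhat.conjugate (J.conjugate m)) (.id ℂ H) * W := by
  have h1 : ∀ n ∈ algM W, W * mapH (J.conjugate n) (.id ℂ H) = mapH (J.conjugate n) (.id ℂ H) * W := by
    intro n hn
    refine mapH_mul_comm_of_algS fun s hs => ?_
    exact VonNeumannAlgebra.mem_commutant_iff.1 (hW.conj_M n hn) s
      ((isLeast_generatedVN (algS W)).1 hs)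
  -- Adjoints of the relation for m* give the commutation with W*; conjugating by Ĵ ⊗ J then turns
  -- W* back into W.
  have h2 : star W * mapH (J.conjugate m) (.id ℂ H) = mapH (J.conjugate m) (.id ℂ H) * star W := by
    have h3 := h1 (star m) (star_mem hm)
    have h4 := congrArg star h3
    rw [star_mul, star_mul, star_mapH, J.star_conjugate, star_star] at h4
    rw [ContinuousLinearMap.star_eq_adjoint (.id ℂ H), ContinuousLinearMap.adjoint_id] at h4
    exact h4.symm
  have h5 := congrArg (Jhat.prod J).conjugate h2
  have h6 : J.conjugate (.id ℂ H) = .id ℂ H := by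
    ext x; simp [J.involutive]
  rwa [AntiunitaryInvolution.conjugate_mul, AntiunitaryInvolution.conjugate_mul,
    hW.star_eq_conjugate, AntiunitaryInvolution.conjugate_conjugate,
    AntiunitaryInvolution.conjugate_prod_mapH, h6] at h5

/-- With U = JĴ one has J ⊗ J = (U ⊗ 1)(Ĵ ⊗ J) = (Ĵ ⊗ J)(U* ⊗ 1), and conjugation of W by Ĵ ⊗ J is
W*. Consequently this operator is inverse to `twist`. -/
theorem conjugate_prod_self (hW : IsQuantumGroupFrame W J Jhat) :
    (J.prod J).conjugate W =
      mapH (J.mulUnitary Jhat) (.id ℂ H) * star W * mapH (Jhat.mulUnitary J) (.id ℂ H) := by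
  have h1 : ∀ t, (J.prod J).toFun t = mapH (J.mulUnitary Jhat) (.id ℂ H) ((Jhat.prod J).toFun t) := by
    have : (J.prod J).toCLM = (mapH (J.mulUnitary Jhat) (.id ℂ H)).comp (Jhat.prod J).toCLM :=
      semilinear_ext fun x y => by simp [Jhat.involutive]
    exact fun t => DFunLike.congr_fun this t
  have h2 : ∀ t, (J.prod J).toFun t = (Jhat.prod J).toFun (mapH (Jhat.mulUnitary J) (.id ℂ H) t) := by
    have : (J.prod J).toCLM = (Jhat.prod J).toCLM.comp (mapH (Jhat.mulUnitary J) (.id ℂ H)) :=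
      semilinear_ext fun x y => by simp [Jhat.involutive]
    exact fun t => DFunLike.congr_fun this t
  refine ContinuousLinearMap.ext fun t => ?_
  rw [AntiunitaryInvolution.conjugate_apply, h2 t, h1, hW.star_eq_conjugate, mul_apply_eq_comp,
    mul_apply_eq_comp, AntiunitaryInvolution.conjugate_apply]

end IsQuantumGroupFrame

/-- `(U ⊗ 1) W (U* ⊗ 1)` for `U = J Ĵ`. -/
def twist (W : HTensor H H →L[ℂ] HTensor H H) (J Jhat : AntiunitaryInvolution H) :
    HTensor H H →L[ℂ] HTensor H H :=
  mapH (J.mulUnitary Jhat) (.id ℂ H) * W * mapH (Jhat.mulUnitary J) (.id ℂ H)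

namespace IsQuantumGroupFrame

theorem mapH_id_mul_mapH_id (a b : H →L[ℂ] H) :
    mapH a (.id ℂ H) * mapH b (.id ℂ H) = mapH (a * b) (.id ℂ H) := by
  refine semilinear_ext fun x y => by simp

theorem mapH_one_id : mapH (1 : H →L[ℂ] H) (.id ℂ H) = 1 := mapH_one

theorem mapH_mulUnitary_mul (J K : AntiunitaryInvolution H) :
    mapH (J.mulUnitary K) (.id ℂ H) * mapH (K.mulUnitary J) (.id ℂ H) = 1 := by
  rw [mapH_id_mul_mapH_id, AntiunitaryInvolution.mulUnitary_mul, mapH_one_id]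

theorem twist_mul_conjugate (hW : IsQuantumGroupFrame W J Jhat) :
    twist W J Jhat * (J.prod J).conjugate W = 1 := by
  rw [hW.conjugate_prod_self, twist]
  calc _ = mapH (J.mulUnitary Jhat) (.id ℂ H) * W *
        (mapH (Jhat.mulUnitary J) (.id ℂ H) * mapH (J.mulUnitary Jhat) (.id ℂ H)) * star W *
        mapH (Jhat.mulUnitary J) (.id ℂ H) := by simp only [mul_assoc]
    _ = 1 := by rw [mapH_mulUnitary_mul, mul_one, mul_assoc _ W, hW.mul_star_self, mul_one, mapH_mulUnitary_mul]

theorem conjugate_mul_twist (hW : IsQuantumGroupFrame W J Jhat) :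
    (J.prod J).conjugate W * twist W J Jhat = 1 := by
  rw [hW.conjugate_prod_self, twist]
  calc _ = mapH (J.mulUnitary Jhat) (.id ℂ H) * star W *
        (mapH (Jhat.mulUnitary J) (.id ℂ H) * mapH (J.mulUnitary Jhat) (.id ℂ H)) * W *
        mapH (Jhat.mulUnitary J) (.id ℂ H) := by simp only [mul_assoc]
    _ = 1 := by rw [mapH_mulUnitary_mul, mul_one, mul_assoc _ (star W), hW.star_mul_self, mul_one, mapH_mulUnitary_mul]

/-- The pentagon equation conjugated by `Ĵ ⊗ J ⊗ J`. -/
theorem leg12_mul_leg23_twist (hW : IsQuantumGroupFrame W J Jhat) :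
    leg12 (star W) * leg23 (twist W J Jhat) =
      leg23 (twist W J Jhat) * (leg12 (star W) * leg13 (star W)) := by
  have h := congrArg (Jhat.prod (J.prod J)).conjugate hW.isMultiplicativeUnitary.pentagon
  simp only [AntiunitaryInvolution.conjugate_mul, AntiunitaryInvolution.conjugate_leg12,
    AntiunitaryInvolution.conjugate_leg13, AntiunitaryInvolution.conjugate_leg23,
    ← hW.star_eq_conjugate] at h
  have h1 : leg23 (twist W J Jhat) * leg23 ((J.prod J).conjugate W) = 1 := by
    rw [← leg23_mul, hW.twist_mul_conjugate, leg23_one]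
  have h2 : leg23 ((J.prod J).conjugate W) * leg23 (twist W J Jhat) = 1 := by
    rw [← leg23_mul, hW.conjugate_mul_twist, leg23_one]
  -- The conjugated pentagon reads W₁₂*W₁₃*V₂₃⁻¹ = V₂₃⁻¹W₁₂* with V the twist; multiply by V₂₃ on
  -- both sides.
  calc leg12 (star W) * leg23 (twist W J Jhat)
      = leg23 (twist W J Jhat) * (leg23 ((J.prod J).conjugate W) * leg12 (star W)) *
          leg23 (twist W J Jhat) := by rw [← mul_assoc, h1, one_mul]
    _ = leg23 (twist W J Jhat) * (leg12 (star W) * leg13 (star W)) *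
          (leg23 ((J.prod J).conjugate W) * leg23 (twist W J Jhat)) := by
        rw [← h]; simp only [mul_assoc]
    _ = _ := by rw [h2, mul_one]

end IsQuantumGroupFrame

end Regularity

/-! ### Weak regularity -/

section Algebra

variable {H : Type u} [NormedAddCommGroup H] [InnerProductSpace ℂ H] [CompleteSpace H]
variable {W : HTensor H H →L[ℂ] HTensor H H} {J Jhat : AntiunitaryInvolution H}

namespace IsQuantumGroupFrame

theorem mapH_id_mapH_id_apply (a b : H →L[ℂ] H) (t : HTensor H H) :
    mapH (a * b) (.id ℂ H) t = mapH a (.id ℂ H) (mapH b (.id ℂ H) t) := by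
  rw [← mapH_id_mul_mapH_id, mul_apply_eq_comp]

theorem twist_apply_mapH (W : HTensor H H →L[ℂ] HTensor H H) (J Jhat : AntiunitaryInvolution H)
    (t : HTensor H H) : mapH (J.mulUnitary Jhat) (.id ℂ H) (W t) =
      twist W J Jhat (mapH (J.mulUnitary Jhat) (.id ℂ H) t) := by
  have h := DFunLike.congr_fun (mapH_mulUnitary_mul Jhat J) t
  rw [mul_apply_eq_comp, one_apply_eq_self] at h
  rw [twist, mul_apply_eq_comp, mul_apply_eq_comp, h]

/-- Since U*sU = ĴJsJĴ commutes with W on the first leg, (U*s ⊗ 1)V = W(U*s ⊗ 1). The leading W is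
what unitarity removes at the end. -/
theorem mapH_twist_apply (hW : IsQuantumGroupFrame W J Jhat) {s : H →L[ℂ] H} (hs : s ∈ algM W)
    (t : HTensor H H) :
    mapH (Jhat.mulUnitary J) (.id ℂ H) (mapH s (.id ℂ H) (twist W J Jhat t)) =
      W (mapH (Jhat.mulUnitary J) (.id ℂ H) (mapH s (.id ℂ H) t)) := by
  have h1 : Jhat.mulUnitary J * s * J.mulUnitary Jhat = Jhat.conjugate (J.conjugate s) := by
    ext x; simp
  have h2 := hW.commute_conjugate hs
  rw [← h1] at h2
  have h3 := DFunLike.congr_fun h2 (mapH (Jhat.mulUnitary J) (.id ℂ H) t)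
  have h4 := DFunLike.congr_fun (mapH_mulUnitary_mul J Jhat) t
  rw [mul_apply_eq_comp, one_apply_eq_self] at h4
  rw [mul_apply_eq_comp, mul_apply_eq_comp, mapH_id_mapH_id_apply, mapH_id_mapH_id_apply,
    mapH_id_mapH_id_apply, mapH_id_mapH_id_apply, h4] at h3
  rw [twist, mul_apply_eq_comp, mul_apply_eq_comp, h3]

/-- The key identity expressing `(U* s ŝ* U ⊗ 1) W (1 ⊗ b)` through `W₁₂* W₁₃*`. -/
theorem mapH_slice_mul_apply (hW : IsQuantumGroupFrame W J Jhat) {s : H →L[ℂ] H}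
    (hs : s ∈ algM W) (p q : H) (d b : H →L[ℂ] H) (t : HTensor H H) :
    mapH (Jhat.mulUnitary J * (s * ((leftLeg q)† ∘L star W ∘L leftLeg (d p))) * J.mulUnitary Jhat)
        (.id ℂ H) (W (mapH (.id ℂ H) b t)) =
      W (mapH (Jhat.mulUnitary J) (.id ℂ H) (mapH s (.id ℂ H)
        (((leftLeg q : HTensor H H →L[ℂ] _)†) (leg12 (star W) (leg13 (star W * mapH d b)
          (leftLeg p (mapH (J.mulUnitary Jhat) (.id ℂ H) t))))))) := by
  -- The slice ŝ* is realized as W₁₂* between vectors on an auxiliary first leg. The twist V₂₃ is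
  -- moved left through W₁₂* at the cost of W₁₃*, then out of the slice, and finally past U*s, where
  -- it becomes W.
  have h1 : ∀ t, mapH ((leftLeg q)† ∘L star W ∘L leftLeg (d p)) (.id ℂ H) t =
      ((leftLeg q : HTensor H H →L[ℂ] _)†) (leg12 (star W) (leftLeg (d p) t)) := fun t =>
    (DFunLike.congr_fun (slice_first_leg12 (star W) q (d p)) t).symm
  have h2 : ∀ t, leftLeg (d p) (twist W J Jhat t) = leg23 (twist W J Jhat) (leftLeg (d p) t) :=
    fun t => (DFunLike.congr_fun (slice_first_leg23 (twist W J Jhat) (d p)) t).symm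
  have h3 : ∀ t, leg12 (star W) (leg23 (twist W J Jhat) t) =
      leg23 (twist W J Jhat) (leg12 (star W) (leg13 (star W) t)) := fun t =>
    DFunLike.congr_fun hW.leg12_mul_leg23_twist t
  have h4 : ∀ t, ((leftLeg q : HTensor H H →L[ℂ] _)†) (leg23 (twist W J Jhat) t) =
      twist W J Jhat (((leftLeg q : HTensor H H →L[ℂ] _)†) t) :=
    adjoint_leftLeg_mapH_id q (twist W J Jhat)
  have h5 : mapH (J.mulUnitary Jhat) (.id ℂ H) (mapH (.id ℂ H) b t) =
      mapH (.id ℂ H) b (mapH (J.mulUnitary Jhat) (.id ℂ H) t) := by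
    have : mapH (J.mulUnitary Jhat) (.id ℂ H) * mapH (.id ℂ H) b =
        mapH (.id ℂ H) b * mapH (J.mulUnitary Jhat) (.id ℂ H) :=
      semilinear_ext fun x y => by simp
    exact DFunLike.congr_fun this t
  have h6 : ∀ t, leftLeg (d p) (mapH (.id ℂ H) b t) =
      leg13 (mapH d b) (leftLeg p t) := fun t => by
    rw [leg13_mapH, leftLeg_apply, leftLeg_apply, mapH_tmulH]
  rw [mapH_id_mapH_id_apply, mapH_id_mapH_id_apply, mapH_id_mapH_id_apply,
    twist_apply_mapH W J Jhat, h5, h1,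
    h2, h3, h4, h6, hW.mapH_twist_apply hs, leg13_mul, mul_apply_eq_comp]

/-- The key identity makes φ vanish on expressions linear and normal in W*(d ⊗ b). Passing from d ⊗
b to W replaces W*(d ⊗ b) by 1, and what remains is W times a slice of W₁₂*, to which trimness
applies. -/
theorem eq_zero_mul_mapH (hW : IsQuantumGroupFrame W J Jhat)
    {φ : (HTensor H H →L[ℂ] HTensor H H) → ℂ} (hφ : IsNormal φ)
    (h : ∀ x b, φ (mapH x (.id ℂ H) * W * mapH (.id ℂ H) b) = 0) (x : H →L[ℂ] H) :
    φ (W * mapH x (.id ℂ H)) = 0 := by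
  have key : ∀ s ∈ algS W, ∀ q p, φ (W * mapH (Jhat.mulUnitary J *
      (s * ((leftLeg q)† ∘L star W ∘L leftLeg p)) * J.mulUnitary Jhat) (.id ℂ H)) = 0 := by
    intro s hs q p
    have hs' : s ∈ algM W := (isLeast_generatedVN (algS W)).1 hs
    -- P and Q collect everything in the key identity surrounding the factor (W*(d ⊗ b))₁₃.
    let P : HTensor H (HTensor H H) →L[ℂ] HTensor H H :=
      W ∘L mapH (Jhat.mulUnitary J) (.id ℂ H) ∘L mapH s (.id ℂ H) ∘L (leftLeg q)† ∘L leg12 (star W)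
    let Q : HTensor H H →L[ℂ] HTensor H (HTensor H H) :=
      leftLeg p ∘L mapH (J.mulUnitary Jhat) (.id ℂ H)
    have hψ : IsNormal fun Y : HTensor H H →L[ℂ] HTensor H H => φ (P ∘L leg13 Y ∘L Q) :=
      (hφ.comp P Q).leg13
    have hz := (hψ.mul_mul (star W) 1).eq_zero_of_mapH (fun d b => by
      rw [mul_one, ← h _ b]
      congr 1
      refine ContinuousLinearMap.ext fun t => ?_
      exact (hW.mapH_slice_mul_apply hs' p q d b t).symm) W
    rw [mul_one, hW.star_mul_self] at hz
    rw [← hz]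
    congr 1
    refine ContinuousLinearMap.ext fun t => ?_
    have h1 := DFunLike.congr_fun (slice_first_leg12 (star W) q p)
      (mapH (J.mulUnitary Jhat) (.id ℂ H) t)
    rw [mul_apply_eq_comp, mapH_id_mapH_id_apply, mapH_id_mapH_id_apply, mapH_id_mapH_id_apply, ← h1,
      leg13_one]
    rfl
  have hn : IsNormal fun z : H →L[ℂ] H =>
      φ (W * mapH (Jhat.mulUnitary J * z * J.mulUnitary Jhat) (.id ℂ H)) := by
    have h1 := (((hφ.mul_mul W 1).amplify_right).mul_mul (Jhat.mulUnitary J) (J.mulUnitary Jhat))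
    simpa only [mul_one] using h1
  -- The argument is UxU*, so that conjugation by U* returns x.
  have h2 := hW.isTrim.eq_zero_of_slices hn key (J.mulUnitary Jhat * x * Jhat.mulUnitary J)
  have h3 : Jhat.mulUnitary J * (J.mulUnitary Jhat * x * Jhat.mulUnitary J) * J.mulUnitary Jhat = x := by
    calc _ = (Jhat.mulUnitary J * J.mulUnitary Jhat) * x * (Jhat.mulUnitary J * J.mulUnitary Jhat) := by
          simp only [mul_assoc]
      _ = x := by rw [AntiunitaryInvolution.mulUnitary_mul, one_mul, mul_one]
  rwa [h3] at h2

/-- Weak regularity: the operators `(x ⊗ 1) W (1 ⊗ b)` are total in `B(H ⊗ H)` for the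
`σ`-weak topology. -/
theorem eq_zero_of_regular (hW : IsQuantumGroupFrame W J Jhat)
    {φ : (HTensor H H →L[ℂ] HTensor H H) → ℂ} (hφ : IsNormal φ)
    (h : ∀ x b, φ (mapH x (.id ℂ H) * W * mapH (.id ℂ H) b) = 0)
    (y : HTensor H H →L[ℂ] HTensor H H) : φ y = 0 := by
  have h1 : ∀ x b, φ (W * mapH x b) = 0 := fun x b => by
    have hn : IsNormal fun z => φ (z * mapH (.id ℂ H) b) := by
      simpa only [one_mul] using hφ.mul_mul 1 (mapH (.id ℂ H) b)
    have h2 := hW.eq_zero_mul_mapH hn (fun x b' => by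
      rw [mul_assoc _ (mapH (.id ℂ H) b'), ← h x (b' * b), mapH_mul]
      rfl) x
    have h3 : mapH x b = mapH x (.id ℂ H) * mapH (.id ℂ H) b := semilinear_ext fun u v => by simp
    rw [h3, ← mul_assoc]
    exact h2
  -- The functional z ↦ φ(Wz) kills all x ⊗ b, hence everything; evaluate it at W*y.
  have h4 := (hφ.mul_mul W 1).eq_zero_of_mapH (fun x b => by rw [mul_one, h1]) (star W * y)
  rwa [mul_one, ← mul_assoc, hW.mul_star_self, one_mul] at h4

end IsQuantumGroupFrame

end Algebra

/-! ### Products and adjoints of slices -/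

section StarAlgebra

variable {H : Type u} [NormedAddCommGroup H] [InnerProductSpace ℂ H] [CompleteSpace H]
variable {W : HTensor H H →L[ℂ] HTensor H H} {J Jhat : AntiunitaryInvolution H}

/-- A normal functional vanishing on slices along elementary tensors vanishes on all slices. -/
theorem IsNormal.eq_zero_of_tmulH {K : Type*} [NormedAddCommGroup K] [InnerProductSpace ℂ K]
    [CompleteSpace K] {φ : (H →L[ℂ] H) → ℂ} (hφ : IsNormal φ) (N : HTensor H H →L[ℂ] H →L[ℂ] K)
    (T : K →L[ℂ] K) (h : ∀ p q p' q', φ ((N (tmulH p q))† ∘L T ∘L N (tmulH p' q')) = 0)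
    (k k' : HTensor H H) : φ ((N k)† ∘L T ∘L N k') = 0 := by
  obtain ⟨ω, -, hω⟩ := hφ.exists_mem_predual
  have hadj : ∀ S : H →L[ℂ] K, Continuous fun k => ω ((N k)† ∘L S) := fun S =>
    ω.continuous.comp ((ContinuousLinearMap.adjoint.continuous.comp N.continuous).clm_comp
      continuous_const)
  have h1 : ∀ k p' q', ω ((N k)† ∘L T ∘L N (tmulH p' q')) = 0 := by
    intro k p' q'
    let F : Submodule ℂ (HTensor H H) :=
      { carrier := {k | ω ((N k)† ∘L T ∘L N (tmulH p' q')) = 0}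
        add_mem' := fun {a b} ha hb => by
          rw [Set.mem_ofPred_eq] at ha hb ⊢
          rw [map_add, map_add, ContinuousLinearMap.add_comp, map_add, ha, hb, add_zero]
        zero_mem' := by
          rw [Set.mem_ofPred_eq, map_zero, map_zero, ContinuousLinearMap.zero_comp, map_zero]
        smul_mem' := fun c a ha => by
          rw [Set.mem_ofPred_eq] at ha ⊢
          rw [map_smul, map_smulₛₗ, ContinuousLinearMap.smul_comp, map_smul, ha, smul_zero] }
    exact mem_of_tmulH_mem F (isClosed_eq (hadj _) continuous_const)
      (fun p q => (hω _).trans (h p q p' q')) k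
  let F : Submodule ℂ (HTensor H H) :=
    { carrier := {k' | ω ((N k)† ∘L T ∘L N k') = 0}
      add_mem' := fun {a b} ha hb => by
        rw [Set.mem_ofPred_eq] at ha hb ⊢
        rw [map_add, ContinuousLinearMap.comp_add, ContinuousLinearMap.comp_add, map_add, ha, hb,
          add_zero]
      zero_mem' := by
        rw [Set.mem_ofPred_eq, map_zero, ContinuousLinearMap.comp_zero,
          ContinuousLinearMap.comp_zero, map_zero]
      smul_mem' := fun c a ha => by
        rw [Set.mem_ofPred_eq] at ha ⊢
        rw [map_smul, ContinuousLinearMap.comp_smul, ContinuousLinearMap.comp_smul, map_smul, ha,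
          smul_zero] }
  rw [← hω]
  refine mem_of_tmulH_mem F (isClosed_eq (ω.continuous.comp
    (continuous_const.clm_comp (continuous_const.clm_comp N.continuous))) continuous_const)
    (fun p q => h1 k p q) k'

namespace IsMultiplicativeUnitary

theorem star_mul_self (hW : IsMultiplicativeUnitary W) : star W * W = 1 :=
  Unitary.star_mul_self_of_mem hW.mem_unitary

theorem mul_star_self (hW : IsMultiplicativeUnitary W) : W * star W = 1 :=
  Unitary.mul_star_self_of_mem hW.mem_unitary

/-- In this form of the pentagon equation the middle factor on leg two and three is free to be
varied by weak regularity. -/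
theorem leg13_mul_leg23_mul_star (hW : IsMultiplicativeUnitary W) :
    leg13 W * leg23 W * leg12 (star W) = leg12 (star W) * leg23 W := by
  have h1 : leg12 (star W) * leg12 W = 1 := by rw [← leg12_mul, hW.star_mul_self, leg12_one]
  have h2 : leg12 W * leg12 (star W) = 1 := by rw [← leg12_mul, hW.mul_star_self, leg12_one]
  calc leg13 W * leg23 W * leg12 (star W)
      = leg12 (star W) * (leg12 W * leg13 W * leg23 W) * leg12 (star W) := by
        simp only [← mul_assoc]; rw [h1, one_mul]
    _ = leg12 (star W) * leg23 W := by
        rw [hW.pentagon, mul_assoc, mul_assoc, h2, mul_one]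

/-- Both outer factors on the right act only on the legs to be sliced, so slicing yields a single
slice of W. -/
theorem leg12_mul_leg13 (hW : IsMultiplicativeUnitary W) :
    leg12 W * leg13 W = leg23 W * leg12 W * leg23 (star W) := by
  have h2 : leg23 W * leg23 (star W) = 1 := by rw [← leg23_mul, hW.mul_star_self, leg23_one]
  rw [← hW.pentagon, mul_assoc (leg12 W * leg13 W), h2, mul_one]

end IsMultiplicativeUnitary

theorem leg23_comp_rightLeg (T : HTensor H H →L[ℂ] HTensor H H) (k : HTensor H H) :
    leg23 T ∘L rightLeg k = rightLeg (T k) :=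
  (mapH_comp_rightLeg (.id ℂ H) T k).trans (ContinuousLinearMap.comp_id _)

theorem adjoint_rightLeg_comp_leg23 (T : HTensor H H →L[ℂ] HTensor H H) (k : HTensor H H) :
    (rightLeg k)† ∘L leg23 T = (rightLeg ((T†) k))† :=
  (adjoint_rightLeg_comp_mapH k (.id ℂ H) T).trans (ContinuousLinearMap.id_comp _)

/-- Slices of `W₁₃ X₂₃ W₁₂*` along the last two legs form a normal functional of `X`. -/
theorem IsNormal.slice_leg23 {φ : (H →L[ℂ] H) → ℂ} (hφ : IsNormal φ)
    (S T : HTensor H (HTensor H H) →L[ℂ] HTensor H (HTensor H H)) (k k' : HTensor H H) :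
    IsNormal fun X : HTensor H H →L[ℂ] HTensor H H =>
      φ ((rightLeg k)† ∘L (S * QGF.leg23 X * T) ∘L rightLeg k') :=
  (hφ.comp ((rightLeg k)† ∘L S) (T ∘L rightLeg k')).leg23

/-- Here x sits on leg two, which S₁₃ does not touch, and b on leg three, which T₁₂ does not touch.
Both can therefore be pulled outside. -/
theorem leg13_mul_leg23_mapH_mul_leg12 (S T X : HTensor H H →L[ℂ] HTensor H H) (x b : H →L[ℂ] H) :
    leg13 S * leg23 (mapH x (.id ℂ H) * X * mapH (.id ℂ H) b) * leg12 T =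
      leg23 (mapH x (.id ℂ H)) * (leg13 S * leg23 X * leg12 T) * leg23 (mapH (.id ℂ H) b) := by
  have h1 := leg13_mul_second S x
  have h2 := leg12_mul_third T b
  rw [← leg23_mapH] at h1 h2
  rw [leg23_mul, leg23_mul]
  calc _ = (leg13 S * leg23 (mapH x (.id ℂ H))) * leg23 X *
        (leg23 (mapH (.id ℂ H) b) * leg12 T) := by simp only [mul_assoc]
    _ = _ := by rw [h1, ← h2]; simp only [mul_assoc]

/-- Operators on the sliced legs are absorbed into the slicing vectors. -/
theorem slice_leg23_mul_mul (A B : HTensor H H →L[ℂ] HTensor H H)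
    (T : HTensor H (HTensor H H) →L[ℂ] HTensor H (HTensor H H)) (k k' : HTensor H H) :
    (rightLeg k)† ∘L (leg23 A * T * leg23 B) ∘L rightLeg k' =
      (rightLeg ((A†) k))† ∘L T ∘L rightLeg (B k') := by
  rw [← adjoint_rightLeg_comp_leg23, ← leg23_comp_rightLeg]
  rfl

/-- Obtained from `slice_leg13_mul_leg12` by taking adjoints, which reverses the order of the legs.
-/
theorem slice_leg12_mul_leg13 (S T : HTensor H H →L[ℂ] HTensor H H) (p q p' q' : H) :
    (rightLeg (tmulH p q))† ∘L (leg12 S * leg13 T) ∘L rightLeg (tmulH p' q') =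
      ((rightLeg p)† ∘L S ∘L rightLeg p') * ((rightLeg q)† ∘L T ∘L rightLeg q') := by
  have h := congrArg star (slice_leg13_mul_leg12 (star T) (star S) p' q' p q)
  rw [star_mul, star_slice_rightLeg, star_slice_rightLeg, star_star, star_star,
    ContinuousLinearMap.star_eq_adjoint, ContinuousLinearMap.adjoint_comp,
    ContinuousLinearMap.adjoint_comp, ContinuousLinearMap.adjoint_adjoint,
    ← ContinuousLinearMap.star_eq_adjoint (_ * _), star_mul, star_leg12, star_leg13, star_star,
    star_star, ContinuousLinearMap.comp_assoc] at h
  exact h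

/-- The span of `S S` is contained in the `σ`-weak closure of `S`. -/
theorem IsMultiplicativeUnitary.eq_zero_on_mul (hW : IsMultiplicativeUnitary W)
    {φ : (H →L[ℂ] H) → ℂ} (hφ : IsNormal φ)
    (h : ∀ p q, φ ((rightLeg p)† ∘L W ∘L rightLeg q) = 0) (p q p' q' : H) :
    φ (((rightLeg p)† ∘L W ∘L rightLeg p') * ((rightLeg q)† ∘L W ∘L rightLeg q')) = 0 := by
  rw [← slice_leg12_mul_leg13, hW.leg12_mul_leg13, slice_leg23_mul_mul]
  refine hφ.eq_zero_of_tmulH rightLeg (leg12 W) (fun p q p' q' => ?_) _ _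
  obtain ⟨ω, -, hω⟩ := hφ.exists_mem_predual
  rw [slice_leg12, ← hω, map_smul, hω, h, smul_zero]

/-- The span of `S S*` is contained in the `σ`-weak closure of `S*`. -/
theorem IsQuantumGroupFrame.eq_zero_on_mul_star (hW : IsQuantumGroupFrame W J Jhat)
    {φ : (H →L[ℂ] H) → ℂ} (hφ : IsNormal φ)
    (h : ∀ p q, φ ((rightLeg p)† ∘L star W ∘L rightLeg q) = 0) (p q p' q' : H) :
    φ (((rightLeg p)† ∘L W ∘L rightLeg p') * ((rightLeg q)† ∘L star W ∘L rightLeg q')) = 0 := by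
  have h1 := hφ.eq_zero_of_tmulH rightLeg (leg12 (star W)) fun p q p' q' => by
    obtain ⟨ω, -, hω⟩ := hφ.exists_mem_predual
    rw [slice_leg12, ← hω, map_smul, hω, h, smul_zero]
  -- Regularity is applied to X ↦ φ(slice of W₁₃X₂₃W₁₂*) and evaluated at X = 1. The slicing vectors
  -- are swapped because the left factor W₁₃ is sliced on leg three.
  have h2 := hW.eq_zero_of_regular (hφ.slice_leg23 (leg13 W) (leg12 (star W))
    (tmulH q p) (tmulH q' p')) (fun x b => by
      rw [leg13_mul_leg23_mapH_mul_leg12, slice_leg23_mul_mul,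
        hW.isMultiplicativeUnitary.leg13_mul_leg23_mul_star]
      have h3 := h1 (((mapH x (.id ℂ H))†) (tmulH q p)) (W (mapH (.id ℂ H) b (tmulH q' p')))
      rw [← leg23_comp_rightLeg W] at h3
      exact h3) 1
  rw [leg23_one, mul_one, slice_leg13_mul_leg12] at h2
  exact h2

/-- `S*` is contained in the `σ`-weak closure of the span of `S S*`. -/
theorem IsMultiplicativeUnitary.eq_zero_on_star (hW : IsMultiplicativeUnitary W)
    {φ : (H →L[ℂ] H) → ℂ} (hφ : IsNormal φ)
    (h : ∀ p q p' q', φ (((rightLeg p)† ∘L W ∘L rightLeg p') *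
      ((rightLeg q)† ∘L star W ∘L rightLeg q')) = 0) (p q : H) :
    φ ((rightLeg p)† ∘L star W ∘L rightLeg q) = 0 := by
  have h1 := hφ.eq_zero_of_tmulH rightLeg (leg13 W * leg12 (star W)) fun p q p' q' => by
    rw [slice_leg13_mul_leg12, h]
  have h2 : ∀ k k', φ ((rightLeg k)† ∘L (leg12 (star W) * leg23 W) ∘L rightLeg k') = 0 := by
    intro k k'
    -- Here the same functional of X kills every x ⊗ b, hence also X = W, for which the pentagon
    -- equation applies.
    have h3 := (hφ.slice_leg23 (leg13 W) (leg12 (star W)) k k').eq_zero_of_mapH (fun x b => by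
      have h4 : mapH x b = mapH x (.id ℂ H) * 1 * mapH (.id ℂ H) b := by
        rw [mul_one, mapH_mul]; rfl
      rw [h4, leg13_mul_leg23_mapH_mul_leg12, slice_leg23_mul_mul, leg23_one, mul_one]
      exact h1 _ _) W
    rwa [hW.leg13_mul_leg23_mul_star] at h3
  obtain ⟨ω, -, hω⟩ := hφ.exists_mem_predual
  by_cases hp : p = 0
  · rw [hp, map_zero, map_zero, ContinuousLinearMap.zero_comp, ← hω, map_zero]
  -- The vector W*(q ⊗ p) cancels W₂₃, and the repeated p on leg three leaves the nonzero scalar ⟨p,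
  -- p⟩.
  have h5 := h2 (tmulH p p) (star W (tmulH q p))
  have h6 : (leg12 (star W) * leg23 W) ∘L rightLeg (star W (tmulH q p)) =
      leg12 (star W) ∘L rightLeg (tmulH q p) := by
    have := leg23_comp_rightLeg W (star W (tmulH q p))
    rw [← mul_apply_eq_comp, hW.mul_star_self, one_apply_eq_self] at this
    rw [← this]
    rfl
  rw [h6, slice_leg12, ← hω, map_smul, hω, smul_eq_mul, mul_eq_zero] at h5
  exact h5.resolve_left (inner_self_ne_zero.2 hp)

end StarAlgebra

/-! ### The closure of S is the von Neumann algebra M -/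

section Closure

variable {H : Type u} [NormedAddCommGroup H] [InnerProductSpace ℂ H] [CompleteSpace H]
variable {W : HTensor H H →L[ℂ] HTensor H H} {J Jhat : AntiunitaryInvolution H}

theorem mem_sigmaWeakClosure_iff_isNormal (A : Submodule ℂ (H →L[ℂ] H)) (x : H →L[ℂ] H) :
    x ∈ sigmaWeakClosure (A : Set (H →L[ℂ] H)) ↔
      ∀ φ : (H →L[ℂ] H) → ℂ, IsNormal φ → (∀ a ∈ A, φ a = 0) → φ x = 0 := by
  rw [mem_sigmaWeakClosure_iff]
  constructor
  · intro h φ hφ h0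
    obtain ⟨ω, hω, hωφ⟩ := hφ.exists_mem_predual
    rw [← hωφ]
    exact h ω hω fun a ha => (hωφ a).trans (h0 a ha)
  · exact fun h ω hω h0 => h ω (isNormal_of_mem_predual hω) h0

/-- Testing on vector slices suffices, since a normal functional killing those kills all normal
slices. -/
theorem mem_sigmaWeakClosure_algS_iff {x : H →L[ℂ] H} :
    x ∈ sigmaWeakClosure (algS W) ↔ ∀ φ : (H →L[ℂ] H) → ℂ, IsNormal φ →
      (∀ p q, φ ((rightLeg p)† ∘L W ∘L rightLeg q) = 0) → φ x = 0 := by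
  rw [algS_eq, mem_sigmaWeakClosure_iff_isNormal]
  exact ⟨fun h φ hφ h0 => h φ hφ fun a ha => hφ.eq_zero_on_algS h0 ha,
    fun h φ hφ h0 => h φ hφ fun p q => h0 _ (slice_rightLeg_mem_algS W p q)⟩

theorem subset_sigmaWeakClosure (s : Set (H →L[ℂ] H)) : s ⊆ sigmaWeakClosure s :=
  @subset_closure _ (sigmaWeakTopology H) s

variable (W) in
/-- The `σ`-weak closure of `S`, as a subspace. -/
def closureS : Submodule ℂ (H →L[ℂ] H) where
  carrier := sigmaWeakClosure (algS W)
  add_mem' {x y} hx hy := by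
    rw [mem_sigmaWeakClosure_algS_iff] at *
    intro φ hφ h
    obtain ⟨ω, -, hω⟩ := hφ.exists_mem_predual
    rw [← hω, map_add, hω, hω, hx φ hφ h, hy φ hφ h, add_zero]
  zero_mem' := by
    rw [mem_sigmaWeakClosure_algS_iff]
    intro φ hφ h
    obtain ⟨ω, -, hω⟩ := hφ.exists_mem_predual
    rw [← hω, map_zero]
  smul_mem' c x hx := by
    rw [mem_sigmaWeakClosure_algS_iff] at *
    intro φ hφ h
    obtain ⟨ω, -, hω⟩ := hφ.exists_mem_predual
    rw [← hω, map_smul, hω, hx φ hφ h, smul_zero]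

/-- Multiplication is separately `σ`-weakly continuous, so one factor is approximated at a time,
starting from products of vector slices. -/
theorem IsMultiplicativeUnitary.mul_mem_sigmaWeakClosure (hW : IsMultiplicativeUnitary W)
    {x y : H →L[ℂ] H} (hx : x ∈ sigmaWeakClosure (algS W)) (hy : y ∈ sigmaWeakClosure (algS W)) :
    x * y ∈ sigmaWeakClosure (algS W) := by
  rw [mem_sigmaWeakClosure_algS_iff] at *
  intro φ hφ h
  have h1 := hx (fun s => φ (1 * s * y)) (hφ.mul_mul 1 y) fun p q => by
    have h2 := hy (fun t => φ (((rightLeg p)† ∘L W ∘L rightLeg q) * t * 1)) (hφ.mul_mul _ 1)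
      fun p' q' => by rw [mul_one]; exact hW.eq_zero_on_mul hφ h _ _ _ _
    simpa only [mul_one, one_mul] using h2
  simpa only [one_mul] using h1

/-- If φ kills S, then a ↦ conj φ(a*) kills S*, hence S S*. As the set of products is self-adjoint,
φ kills S S* too, and therefore S*. -/
theorem IsQuantumGroupFrame.star_mem_sigmaWeakClosure (hW : IsQuantumGroupFrame W J Jhat)
    {x : H →L[ℂ] H} (hx : x ∈ sigmaWeakClosure (algS W)) :
    star x ∈ sigmaWeakClosure (algS W) := by
  rw [mem_sigmaWeakClosure_algS_iff] at *
  intro φ hφ h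
  have h1 := hW.eq_zero_on_mul_star hφ.star fun p q => by
    rw [star_slice_rightLeg, star_star, h, map_zero]
  have h2 := hW.isMultiplicativeUnitary.eq_zero_on_star hφ fun p q p' q' => by
    have h3 := h1 q' p' q p
    rw [star_mul, star_slice_rightLeg, star_slice_rightLeg, star_star] at h3
    exact (map_eq_zero _).1 h3
  have h4 := hx _ hφ.star fun p q => by rw [star_slice_rightLeg, h2, map_zero]
  exact (map_eq_zero _).1 h4

/-- A vector v killed by S satisfies W(v ⊗ v) = 0, and W is injective. This is the nondegeneracy
required by the double commutant theorem. -/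
theorem IsMultiplicativeUnitary.eq_zero_of_algS (hW : IsMultiplicativeUnitary W) {v : H}
    (h : ∀ s ∈ algS W, s v = 0) : v = 0 := by
  have h1 : W (tmulH v v) = 0 := eq_zero_of_inner_tmulH fun x y => by
    have h2 := congrArg (fun z => ⟪x, z⟫_ℂ) (h _ (slice_rightLeg_mem_algS W y v))
    simpa only [ContinuousLinearMap.comp_apply, rightLeg_apply, inner_zero_right,
      ContinuousLinearMap.adjoint_inner_right] using h2
  have h3 : tmulH v v = 0 := by
    have h4 := DFunLike.congr_fun hW.star_mul_self (tmulH v v)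
    rwa [mul_apply_eq_comp, h1, map_zero, one_apply_eq_self, eq_comm] at h4
  simpa [norm_tmulH] using congrArg norm h3

/-- Commutation with m is detected by the normal functionals a ↦ ⟨u, (ma - am)v⟩, so it passes to
the closure. -/
theorem sigmaWeakClosure_algS_subset : sigmaWeakClosure (algS W) ⊆ (algM W : Set (H →L[ℂ] H)) := by
  intro x hx
  rw [mem_sigmaWeakClosure_algS_iff] at hx
  refine mem_generatedVN_iff.2 fun m hm => ?_
  refine ContinuousLinearMap.ext fun v => ext_inner_left ℂ fun u => ?_
  have hn := ((isNormal_vector u v).mul_mul m 1).add (((isNormal_vector u v).mul_mul 1 m).smul (-1))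
  have h := hx _ hn fun p q => by
    have := hm _ (Or.inl (slice_rightLeg_mem_algS W p q))
    rw [mul_one, one_mul, this]
    ring
  rw [mul_one, one_mul] at h
  linear_combination h

/-- The `σ`-weak closure of `S` is the von Neumann algebra `M`. -/
theorem IsQuantumGroupFrame.sigmaWeakClosure_algS (hW : IsQuantumGroupFrame W J Jhat) :
    sigmaWeakClosure (algS W) = (algM W : Set (H →L[ℂ] H)) := by
  refine Set.Subset.antisymm sigmaWeakClosure_algS_subset fun x hx => ?_
  have hS : algS W ⊆ (closureS W : Set (H →L[ℂ] H)) := subset_sigmaWeakClosure _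
  have hst : ∀ a ∈ closureS W, star a ∈ closureS W := fun a ha => hW.star_mem_sigmaWeakClosure ha
  have hx' : x ∈ Set.centralizer (Set.centralizer (closureS W : Set (H →L[ℂ] H))) := by
    refine Set.centralizer_subset (Set.centralizer_subset (Set.union_subset hS fun a ha => ?_))
      (mem_generatedVN_iff.1 hx)
    rw [← star_star a]
    exact hst _ (hS ha)
  rw [mem_sigmaWeakClosure_algS_iff]
  intro φ hφ h
  refine eq_zero_of_mem_bicommutant (A := closureS W)
    (fun a ha b hb => hW.isMultiplicativeUnitary.mul_mem_sigmaWeakClosure ha hb) hst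
    (fun v hv => hW.isMultiplicativeUnitary.eq_zero_of_algS fun s hs => hv s (hS hs)) hx' hφ
    fun a ha => ?_
  exact mem_sigmaWeakClosure_algS_iff.1 ha φ hφ h

end Closure

/-! ### The dual multiplicative unitary and the statement for Ŝ -/

section Duality

variable {H : Type u} [NormedAddCommGroup H] [InnerProductSpace ℂ H] [CompleteSpace H]
variable {W : HTensor H H →L[ℂ] HTensor H H} {J Jhat : AntiunitaryInvolution H}

/-- The dual `Σ W* Σ` of a multiplicative unitary. -/
def dual (W : HTensor H H →L[ℂ] HTensor H H) : HTensor H H →L[ℂ] HTensor H H :=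
  flipH * star W * flipH

theorem star_dual (W : HTensor H H →L[ℂ] HTensor H H) : star (dual W) = flipH * W * flipH := by
  rw [dual, star_mul, star_mul, star_flipH, star_star, mul_assoc]

variable (H) in
/-- The reversal `x ⊗ y ⊗ z ↦ z ⊗ y ⊗ x`. -/
def reverseH : HTensor H (HTensor H H) →L[ℂ] HTensor H (HTensor H H) :=
  leg12 flipH * leg23 flipH * leg12 flipH

theorem leg12_flipH_tmulH (x y z : H) :
    leg12 flipH (tmulH x (tmulH y z)) = tmulH y (tmulH x z) := by
  rw [← assocH_tmulH, leg12_apply, flipH_tmulH, assocH_tmulH]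

@[simp] theorem reverseH_tmulH (x y z : H) :
    reverseH H (tmulH x (tmulH y z)) = tmulH z (tmulH y x) := by
  simp only [reverseH, mul_apply_eq_comp, leg12_flipH_tmulH, leg23_tmulH, flipH_tmulH]

theorem reverseH_mul_reverseH : reverseH H * reverseH H = 1 :=
  semilinear_ext₃ fun x y z => by
    rw [mul_apply_eq_comp, reverseH_tmulH, reverseH_tmulH, one_apply_eq_self]

/-- Identities that are normal in T can be checked on T = a ⊗ b; this is how the leg relabellings
below are verified. -/
theorem IsNormal.ext_mapH {φ ψ : (HTensor H H →L[ℂ] HTensor H H) → ℂ} (hφ : IsNormal φ)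
    (hψ : IsNormal ψ) (h : ∀ a b : H →L[ℂ] H, φ (mapH a b) = ψ (mapH a b))
    (T : HTensor H H →L[ℂ] HTensor H H) : φ T = ψ T := by
  have := (hφ.add (hψ.smul (-1))).eq_zero_of_mapH (fun a b => by rw [h]; ring) T
  linear_combination this

theorem flipH_mul_mapH_mul_flipH (a b : H →L[ℂ] H) : flipH * mapH a b * flipH = mapH b a :=
  semilinear_ext fun x y => by simp

theorem reverseH_conj_leg12 (T : HTensor H H →L[ℂ] HTensor H H) :
    reverseH H * leg12 T * reverseH H = leg23 (flipH * T * flipH) := by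
  refine ContinuousLinearMap.ext fun v => ext_inner_left ℂ fun u => ?_
  refine ((isNormal_vector u v).mul_mul (reverseH H) (reverseH H)).leg12.ext_mapH
    ((isNormal_vector u v).leg23.mul_mul flipH flipH) (fun a b => ?_) T
  have : reverseH H * leg12 (mapH a b) * reverseH H = leg23 (mapH b a) :=
    semilinear_ext₃ fun x y z => by
      simp only [mul_apply_eq_comp, reverseH_tmulH, leg12_mapH, leg23_mapH, mapH_tmulH]
  rw [this, flipH_mul_mapH_mul_flipH]

theorem reverseH_conj_leg13 (T : HTensor H H →L[ℂ] HTensor H H) :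
    reverseH H * leg13 T * reverseH H = leg13 (flipH * T * flipH) := by
  refine ContinuousLinearMap.ext fun v => ext_inner_left ℂ fun u => ?_
  refine ((isNormal_vector u v).mul_mul (reverseH H) (reverseH H)).leg13.ext_mapH
    ((isNormal_vector u v).leg13.mul_mul flipH flipH) (fun a b => ?_) T
  have : reverseH H * leg13 (mapH a b) * reverseH H = leg13 (mapH b a) :=
    semilinear_ext₃ fun x y z => by
      simp only [mul_apply_eq_comp, reverseH_tmulH, leg13_mapH, mapH_tmulH]
  rw [this, flipH_mul_mapH_mul_flipH]

theorem reverseH_conj_leg23 (T : HTensor H H →L[ℂ] HTensor H H) :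
    reverseH H * leg23 T * reverseH H = leg12 (flipH * T * flipH) := by
  refine ContinuousLinearMap.ext fun v => ext_inner_left ℂ fun u => ?_
  refine ((isNormal_vector u v).mul_mul (reverseH H) (reverseH H)).leg23.ext_mapH
    ((isNormal_vector u v).leg12.mul_mul flipH flipH) (fun a b => ?_) T
  have : reverseH H * leg23 (mapH a b) * reverseH H = leg12 (mapH b a) :=
    semilinear_ext₃ fun x y z => by
      simp only [mul_apply_eq_comp, reverseH_tmulH, leg12_mapH, leg23_mapH, mapH_tmulH]
  rw [this, flipH_mul_mapH_mul_flipH]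

theorem reverseH_conj_mul (S T : HTensor H (HTensor H H) →L[ℂ] HTensor H (HTensor H H)) :
    reverseH H * (S * T) * reverseH H =
      (reverseH H * S * reverseH H) * (reverseH H * T * reverseH H) := by
  calc _ = reverseH H * S * (1 * (T * reverseH H)) := by simp only [mul_assoc, one_mul]
    _ = _ := by rw [← reverseH_mul_reverseH]; simp only [mul_assoc]

/-- Taking adjoints reverses the factors of the pentagon equation and reversing the three legs
exchanges 12 with 23, which restores its shape for ΣW*Σ. -/
theorem IsMultiplicativeUnitary.dual (hW : IsMultiplicativeUnitary W) :
    IsMultiplicativeUnitary (dual W) where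
  mem_unitary := by
    have h : (flipH : HTensor H H →L[ℂ] HTensor H H) ∈ unitary (HTensor H H →L[ℂ] HTensor H H) := by
      rw [Unitary.mem_iff, star_flipH, flipH_mul_flipH]
      exact ⟨rfl, rfl⟩
    exact mul_mem (mul_mem h (Unitary.star_mem hW.mem_unitary)) h
  pentagon := by
    have h := congrArg (fun T => reverseH H * T * reverseH H) (congrArg star hW.pentagon)
    simp only [star_mul, star_leg12, star_leg13, star_leg23] at h
    rw [reverseH_conj_mul, reverseH_conj_mul, reverseH_conj_mul, reverseH_conj_leg12,
      reverseH_conj_leg13, reverseH_conj_leg23] at h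
    rw [mul_assoc]
    exact h

/-- The adjoint of the slice of T by ω is the slice of T* by the normal functional a ↦ conj ω(a*).
-/
theorem star_mem_sliceSubmodule {K : Type*} [NormedAddCommGroup K] [InnerProductSpace ℂ K]
    [CompleteSpace K] {L : H →L[ℂ] H →L[ℂ] K} {T : K →L[ℂ] K} {s : H →L[ℂ] H}
    (hs : s ∈ sliceSubmodule L T) : star s ∈ sliceSubmodule L (star T) := by
  obtain ⟨ω, hω, rfl⟩ := hs
  obtain ⟨ω', hω', h⟩ := (isNormal_of_mem_predual hω).star.exists_mem_predual
  refine ⟨ω', hω', ContinuousLinearMap.ext fun x => ext_inner_left ℂ fun y => ?_⟩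
  rw [inner_sliceAlong, h, ContinuousLinearMap.star_eq_adjoint (sliceAlong L T ω),
    ContinuousLinearMap.adjoint_inner_right, ← inner_conj_symm, inner_sliceAlong,
    ContinuousLinearMap.star_eq_adjoint, ContinuousLinearMap.star_eq_adjoint,
    ContinuousLinearMap.adjoint_comp, ContinuousLinearMap.adjoint_comp,
    ContinuousLinearMap.adjoint_adjoint, ContinuousLinearMap.adjoint_adjoint,
    ContinuousLinearMap.comp_assoc]

theorem sliceAlong_leftLeg_flipH (T : HTensor H H →L[ℂ] HTensor H H)
    (ω : StrongDual ℂ (H →L[ℂ] H)) :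
    sliceAlong leftLeg (flipH * T * flipH) ω = sliceAlong rightLeg T ω := by
  refine ContinuousLinearMap.ext fun x => ext_inner_left ℂ fun y => ?_
  rw [inner_sliceAlong, inner_sliceAlong, ← flipH_comp_leftLeg x, ← flipH_comp_leftLeg y,
    ContinuousLinearMap.adjoint_comp, adjoint_flipH]
  rfl

theorem sliceAlong_rightLeg_flipH (T : HTensor H H →L[ℂ] HTensor H H)
    (ω : StrongDual ℂ (H →L[ℂ] H)) :
    sliceAlong rightLeg (flipH * T * flipH) ω = sliceAlong leftLeg T ω := by
  refine ContinuousLinearMap.ext fun x => ext_inner_left ℂ fun y => ?_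
  rw [inner_sliceAlong, inner_sliceAlong, ← flipH_comp_rightLeg x, ← flipH_comp_rightLeg y,
    ContinuousLinearMap.adjoint_comp, adjoint_flipH]
  rfl

theorem mem_algS_dual {s : H →L[ℂ] H} : s ∈ algS (dual W) ↔ star s ∈ algShat W := by
  have h : algS (dual W) = (sliceSubmodule rightLeg (star W) : Set (H →L[ℂ] H)) :=
    Set.ext fun s => exists_congr fun ω => and_congr_right fun _ => by
      rw [sliceRight, dual, sliceAlong_leftLeg_flipH]
  rw [h, algShat_eq]
  refine ⟨fun hs => ?_, fun hs => ?_⟩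
  · rw [← star_star W]; exact star_mem_sliceSubmodule hs
  · rw [← star_star s]; exact star_mem_sliceSubmodule hs

theorem mem_algShat_dual {s : H →L[ℂ] H} : s ∈ algShat (dual W) ↔ star s ∈ algS W := by
  have h : algShat (dual W) = (sliceSubmodule leftLeg (star W) : Set (H →L[ℂ] H)) :=
    Set.ext fun s => exists_congr fun ω => and_congr_right fun _ => by
      rw [sliceLeft, dual, sliceAlong_rightLeg_flipH]
  rw [h, algS_eq]
  refine ⟨fun hs => ?_, fun hs => ?_⟩
  · rw [← star_star W]; exact star_mem_sliceSubmodule hs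
  · rw [← star_star s]; exact star_mem_sliceSubmodule hs

theorem generatedVN_star (s : Set (H →L[ℂ] H)) : generatedVN (star s) = generatedVN s :=
  SetLike.ext fun x => by rw [mem_generatedVN_iff, mem_generatedVN_iff, star_star, Set.union_comm]

theorem algM_dual : algM (dual W) = algMhat W := by
  rw [algM, algMhat, ← generatedVN_star (algShat W)]
  exact congrArg generatedVN (Set.ext fun s => mem_algS_dual)

theorem algMhat_dual : algMhat (dual W) = algM W := by
  rw [algM, algMhat, ← generatedVN_star (algS W)]
  exact congrArg generatedVN (Set.ext fun s => mem_algShat_dual)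

theorem adjoint_midLeg_comp_leg13 (T : HTensor H H →L[ℂ] HTensor H H) (k : HTensor H H) :
    (midLeg k)† ∘L leg13 (star T) = (midLeg (T k))† := by
  rw [← leg13_comp_midLeg, ContinuousLinearMap.adjoint_comp, ← star_leg13,
    ContinuousLinearMap.star_eq_adjoint]

/-- W₁₃* acts on the outer legs only, so slicing those legs compares S Ŝ* with Ŝ* S. -/
theorem IsMultiplicativeUnitary.leg23_mul_leg12_star (hW : IsMultiplicativeUnitary W) :
    leg23 W * leg12 (star W) = leg13 (star W) * (leg12 (star W) * leg23 W) := by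
  have h : leg13 (star W) * leg13 W = 1 := by rw [← leg13_mul, hW.star_mul_self, leg13_one]
  rw [← hW.leg13_mul_leg23_mul_star, ← mul_assoc, ← mul_assoc, h, one_mul]

/-- The span of `S Ŝ*` is contained in the `σ`-weak closure of the span of `Ŝ* S`. -/
theorem IsMultiplicativeUnitary.eq_zero_on_mul_star (hW : IsMultiplicativeUnitary W)
    {φ : (H →L[ℂ] H) → ℂ} (hφ : IsNormal φ)
    (h : ∀ p q p' q', φ (((leftLeg p)† ∘L star W ∘L leftLeg p') *
      ((rightLeg q)† ∘L W ∘L rightLeg q')) = 0) (p q p' q' : H) :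
    φ (((rightLeg q)† ∘L W ∘L rightLeg q') * ((leftLeg p)† ∘L star W ∘L leftLeg p')) = 0 := by
  have h1 := hφ.eq_zero_of_tmulH midLeg (leg12 (star W) * leg23 W) (fun p q p' q' => by
    rw [slice_leg12_mul_leg23, h]) (W (tmulH p q)) (tmulH p' q')
  rw [← slice_leg23_mul_leg12, hW.leg23_mul_leg12_star]
  rw [← adjoint_midLeg_comp_leg13] at h1
  exact h1

/-- For the dual, the products s ŝ* run over Ŝ* S instead of S Ŝ*. The pentagon equation shows that
the former span is dense when the latter is. -/
theorem IsMultiplicativeUnitary.isTrim_dual (hW : IsMultiplicativeUnitary W) (h : IsTrim W) :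
    IsTrim (QGF.dual W) := by
  refine Set.eq_univ_of_forall fun x => ?_
  rw [mem_sigmaWeakClosure_iff_isNormal]
  intro φ hφ h0
  refine h.eq_zero_of_slices hφ (fun s hs p q => ?_) x
  have h1 := (hφ.mul_mul 1 ((leftLeg p)† ∘L star W ∘L leftLeg q)).eq_zero_on_algS (W := W)
    (fun p' q' => ?_) hs
  · rwa [one_mul] at h1
  rw [one_mul]
  refine hW.eq_zero_on_mul_star hφ (fun a b a' b' => ?_) _ _ _ _
  refine h0 _ (Submodule.subset_span ⟨(leftLeg a)† ∘L star W ∘L leftLeg a', mem_algS_dual.2 ?_,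
    star ((rightLeg b)† ∘L W ∘L rightLeg b'), mem_algShat_dual.2 ?_, ?_⟩)
  · rw [star_slice_leftLeg, star_star]
    exact slice_leftLeg_mem_algShat W a' a
  · rw [star_star]
    exact slice_rightLeg_mem_algS W b b'
  · rw [star_star]

theorem conjugate_prod_flipH (J K : AntiunitaryInvolution H) (T : HTensor H H →L[ℂ] HTensor H H) :
    (J.prod K).conjugate (flipH * T * flipH) = flipH * (K.prod J).conjugate T * flipH := by
  have h : ∀ (J K : AntiunitaryInvolution H) t,
      (J.prod K).toFun (flipH t) = flipH ((K.prod J).toFun t) := fun J K t => by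
    have : (J.prod K).toCLM.comp flipH =
        (flipH : HTensor H H →L[ℂ] HTensor H H).comp (K.prod J).toCLM :=
      semilinear_ext fun x y => by simp
    exact DFunLike.congr_fun this t
  refine ContinuousLinearMap.ext fun t => ?_
  rw [AntiunitaryInvolution.conjugate_apply, mul_apply_eq_comp, mul_apply_eq_comp,
    mul_apply_eq_comp, mul_apply_eq_comp, AntiunitaryInvolution.conjugate_apply, h, ← h K J]

/-- The flip exchanges Ĵ ⊗ J with J ⊗ Ĵ and M with M̂, so the two involutions swap roles. -/
theorem IsQuantumGroupFrame.dual (hW : IsQuantumGroupFrame W J Jhat) :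
    IsQuantumGroupFrame (dual W) Jhat J where
  isMultiplicativeUnitary := hW.isMultiplicativeUnitary.dual
  isTrim := hW.isMultiplicativeUnitary.isTrim_dual hW.isTrim
  star_eq := by
    have h : star (QGF.dual W) = (J.prod Jhat).conjugate (QGF.dual W) := by
      rw [star_dual, QGF.dual, conjugate_prod_flipH, hW.star_eq_conjugate,
        AntiunitaryInvolution.conjugate_conjugate]
    rw [h, AntiunitaryInvolution.tensor_eq_toCLM]
    rfl
  conj_M := by rw [algM_dual]; exact hW.conj_Mhat
  conj_Mhat := by rw [algMhat_dual]; exact hW.conj_M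

/-- The `σ`-weak closure of `Ŝ` is the von Neumann algebra `M̂`. -/
theorem IsQuantumGroupFrame.sigmaWeakClosure_algShat (hW : IsQuantumGroupFrame W J Jhat) :
    sigmaWeakClosure (algShat W) = (algMhat W : Set (H →L[ℂ] H)) := by
  have h := hW.dual.sigmaWeakClosure_algS
  rw [algM_dual] at h
  -- The slices of the dual are the adjoints of those in Ŝ, and taking adjoints preserves normality
  -- of functionals, hence closures.
  have key : ∀ x, x ∈ sigmaWeakClosure (algShat W) ↔ star x ∈ sigmaWeakClosure (algS (QGF.dual W)) := by
    intro x
    rw [algShat_eq, algS_eq, mem_sigmaWeakClosure_iff_isNormal, mem_sigmaWeakClosure_iff_isNormal]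
    refine ⟨fun hx φ hφ h0 => ?_, fun hx φ hφ h0 => ?_⟩
    · refine (map_eq_zero _).1 (hx _ hφ.star fun a ha => ?_)
      rw [h0 (star a) (mem_algS_dual.2 (by rwa [star_star])), map_zero]
    · have := hx _ hφ.star fun a ha => by rw [h0 (star a) (mem_algS_dual.1 ha), map_zero]
      rw [star_star] at this
      exact (map_eq_zero _).1 this
  ext x
  rw [key, h]
  exact star_mem_iff

end Duality

end QGF

end


theorem mainTheorem1 {H : Type*} [NormedAddCommGroup H] [InnerProductSpace ℂ H] [CompleteSpace H]
    (W : QGF.HTensor H H →L[ℂ] QGF.HTensor H H) (J Jhat : QGF.AntiunitaryInvolution H)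
    (hW : QGF.IsQuantumGroupFrame W J Jhat) :
    ((∃ A : NonUnitalStarSubalgebra ℂ (H →L[ℂ] H),
        (A : Set (H →L[ℂ] H)) = QGF.sigmaWeakClosure (QGF.algS W)) ∧
      QGF.sigmaWeakClosure (QGF.algS W) = (QGF.algM W : Set (H →L[ℂ] H))) ∧
    ((∃ A : NonUnitalStarSubalgebra ℂ (H →L[ℂ] H),
        (A : Set (H →L[ℂ] H)) = QGF.sigmaWeakClosure (QGF.algShat W)) ∧
      QGF.sigmaWeakClosure (QGF.algShat W) = (QGF.algMhat W : Set (H →L[ℂ] H))) := by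
  have h := hW.sigmaWeakClosure_algS
  have h' := hW.sigmaWeakClosure_algShat
  exact ⟨⟨⟨(QGF.algM W).toStarSubalgebra.toNonUnitalStarSubalgebra, h.symm⟩, h⟩,
    ⟨(QGF.algMhat W).toStarSubalgebra.toNonUnitalStarSubalgebra, h'.symm⟩, h'⟩
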